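/- Let $n\ge 1$, let $1\le s_j<q_j\le\infty$ for $1\le j\le n$, and define $q\in(0,\infty]$ by $\frac1q=\frac1{q_1}+\dots+\frac1{q_n}$ (with $\frac1\infty=0$). For measurable functions $f_1,\dots,f_n$ on $\mathbb R$ let $$\vec{\mathcal M}_{s_1,\dots,s_n}(f_1,\dots,f_n)(x)=\sup_{Q\ni x}\ \prod_{j=1}^n\Big(\frac1{|Q|}\int_Q|f_j(y)|^{s_j}\,dy\Big)^{1/s_j},$$ where the supremum is over all bounded open intervals $Q\subset\mathbb R$ that contain $x$ (and $0\cdot\infty=0$). Let $\vec w=(w_1,\dots,w_n)$ be a vector of weights on $\mathbb R$, that is, of locally integrable functions that are positive almost everywhere, with $w_j\equiv 1$ whenever $q_j=\infty$, and put $\nu_{\vec w}=\prod_{j=1}^n w_j^{q/q_j}$, where the factors with $q_j=\infty$ are equal to $1$. Then there is a constant $C<\infty$ (which may depend on $n$, $s_j$, $q_j$ and $\vec w$, but not on the functions) such that $$\big\|\vec{\mathcal M}_{s_1,\dots,s_n}(f_1,\dots,f_n)\big\|_{L^q(\nu_{\vec w})}\le C\prod_{j=1}^n\|f_j\|_{L^{q_j}(w_j)}$$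 for all measurable functions $f_1,\dots,f_n$ on $\mathbb R$ if and only if $\vec w$ satisfies the $A_{\vec q,\vec s}$ condition $$\sup_{Q}\Big(\frac1{|Q|}\int_Q\nu_{\vec w}\Big)^{1/q}\prod_{j=1}^n\Big(\frac1{|Q|}\int_Q w_j^{-\frac{s_j}{q_j-s_j}}\Big)^{\frac1{s_j}-\frac1{q_j}}<\infty,$$ the supremum being over all bounded nondegenerate intervals $Q\subset\mathbb R$. Here $L^p(w)$ denotes the Lebesgue space $L^p(\mathbb R, w\,dx)$ (quasi-normed if $p<1$), and for $q_j=\infty$ one reads $\frac{s_j}{q_j-s_j}=0$. -/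

import Mathlib

open MeasureTheory
open scoped NNReal ENNReal

/-- A weight on the real line: a locally integrable function that is positive almost everywhere. -/
def IsWeight (w : ℝ → ℝ) : Prop :=
  LocallyIntegrable w volume ∧ ∀ᵐ x ∂(volume : Measure ℝ), 0 < w x

/-- The measure `w dx` on the real line. -/
noncomputable def weightMeasure (w : ℝ → ℝ) : Measure ℝ :=
  volume.withDensity (fun x => ENNReal.ofReal (w x))

/-- The multi-(sub)linear maximal operator
`M(f₁, …, fₙ)(x) = sup_{Q ∋ x} ∏ⱼ (|Q|⁻¹ ∫_Q |fⱼ|^{sⱼ})^{1/sⱼ}`, the supremum being over all bounded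
open intervals `Q = (a, b)` that contain `x`. -/
noncomputable def multiMaximal {n : ℕ} (s : Fin n → ℝ≥0) (f : Fin n → ℝ → ℂ) (x : ℝ) : ℝ≥0∞ :=
  ⨆ (a : ℝ) (b : ℝ) (_ : x ∈ Set.Ioo a b),
    ∏ j, (⨍⁻ y in Set.Ioo a b, ‖f j y‖ₑ ^ (s j : ℝ) ∂volume) ^ (1 / (s j : ℝ))

/-- The product weight `ν = ∏ⱼ wⱼ^{q/qⱼ}`; here `q₀` is the target exponent `q`. The extended
quotient `q₀ / q j` is `0` when `q j = ∞`. -/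
noncomputable def productWeight {n : ℕ} (q : Fin n → ℝ≥0∞) (q₀ : ℝ≥0∞) (w : Fin n → ℝ → ℝ)
    (x : ℝ) : ℝ :=
  ∏ j, w j x ^ (q₀ / q j).toReal

/-- The characteristic
`sup_Q (⨍_Q ν)^{1/q} ∏ⱼ (⨍_Q wⱼ^{-sⱼ/(qⱼ-sⱼ)})^{1/sⱼ-1/qⱼ}` of a vector weight, the supremum being
over all bounded intervals. The exponents are computed in `[0, ∞]`, so that `1/q = 0` for `q = ∞`
and `sⱼ/(qⱼ-sⱼ) = 0` for `qⱼ = ∞`. -/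
noncomputable def vectorWeightConst {n : ℕ} (s : Fin n → ℝ≥0) (q : Fin n → ℝ≥0∞) (q₀ : ℝ≥0∞)
    (w : Fin n → ℝ → ℝ) : ℝ≥0∞ :=
  ⨆ (a : ℝ) (b : ℝ) (_ : a < b),
    (⨍⁻ x in Set.Ioo a b, ENNReal.ofReal (productWeight q q₀ w x) ∂volume) ^ (q₀⁻¹).toReal *
      ∏ j, (⨍⁻ x in Set.Ioo a b,
          ENNReal.ofReal (w j x ^ (-((s j : ℝ≥0∞) / (q j - (s j : ℝ≥0∞))).toReal)) ∂volume)
        ^ (1 / (s j : ℝ) - ((q j)⁻¹).toReal)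

/-- The vector weight condition `A_{q⃗, s⃗}`. -/
def IsVectorWeightClass {n : ℕ} (s : Fin n → ℝ≥0) (q : Fin n → ℝ≥0∞) (q₀ : ℝ≥0∞)
    (w : Fin n → ℝ → ℝ) : Prop :=
  vectorWeightConst s q q₀ w < ∞

/-!
Write `σ j` for the dual weights `w j ^ (-s j / (q j - s j))` and `g j = |f j| ^ s j`, so that
`‖f j‖` in `L^{q j}(w j)` is the `L^{q j}`-norm of `g j ^ (1 / s j)` against a power of `σ j`.

Necessity: test the inequality on `g j = 1_Q * min (σ j) N`. On `Q` the maximal function is at least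
the product of the averages over `Q`, which bounds the characteristic on `Q` with `σ j` replaced by
its truncation; let `N → ∞`.

Sufficiency: the maximal operator of an arbitrary measure on the line is of weak type `(1, 1)`,
since finitely many intervals can be thinned out to overlap at most twice without changing their
union, hence bounded on `L^p` for `p > 1`. Replacing each average of `g j` over `Q` by
`⨍_Q σ j` times a value of `M_j`, the maximal function of `g j / σ j` with respect to `σ j`,
Hölder's inequality and the `A`-condition, of characteristic `K`, give, for large `γ`,
`M(f) ≤ K ^ γ * M_ν(F) ^ (γ / q)` with `F` a power of `∏ j, σ j ^ (-b j) * M_j ^ (1 / s j)`.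
As `γ > 1`, the maximal operator `M_ν` is bounded on the relevant space, and its bound leaves the
`L^q`-norm of `∏ j, M_j ^ (1 / s j) * σ j ^ (1 / q j)`, to which Hölder's inequality and the bounds
of the `M_j` apply. For `q = ∞` the detour through `M_ν` is not needed.
-/

section IntervalMaximal

/-- The uncentred maximal function of `h` over bounded open intervals, with averages taken with
respect to an arbitrary measure `μ`. Intervals whose `μ`-measure is `0` or `∞` contribute the
average `0`. -/
noncomputable def intervalMaximal (μ : Measure ℝ) (h : ℝ → ℝ≥0∞) (x : ℝ) : ℝ≥0∞ :=
  ⨆ (a : ℝ) (b : ℝ) (_ : x ∈ Set.Ioo a b), ⨍⁻ y in Set.Ioo a b, h y ∂μ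

theorem laverage_le_intervalMaximal (μ : Measure ℝ) (h : ℝ → ℝ≥0∞) {a b x : ℝ}
    (hx : x ∈ Set.Ioo a b) : ⨍⁻ y in Set.Ioo a b, h y ∂μ ≤ intervalMaximal μ h x :=
  le_iSup₂_of_le a b (le_iSup_of_le hx le_rfl)

theorem intervalMaximal_le_essSup (μ : Measure ℝ) (h : ℝ → ℝ≥0∞) (x : ℝ) :
    intervalMaximal μ h x ≤ essSup h μ :=
  iSup₂_le fun _ _ => iSup_le fun _ => setLAverage_le_essSup _ _

theorem lowerSemicontinuous_intervalMaximal (μ : Measure ℝ) (h : ℝ → ℝ≥0∞) :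
    LowerSemicontinuous (intervalMaximal μ h) := by
  have hM : intervalMaximal μ h = fun x => ⨆ a, ⨆ b,
      (Set.Ioo a b).indicator (fun _ => ⨍⁻ y in Set.Ioo a b, h y ∂μ) x := by
    classical
    ext x
    simp only [intervalMaximal, iSup_eq_if, Set.indicator_apply, bot_eq_zero]
  rw [hM]
  exact lowerSemicontinuous_iSup fun a => lowerSemicontinuous_iSup fun b =>
    isOpen_Ioo.lowerSemicontinuous_indicator zero_le

theorem measurable_intervalMaximal (μ : Measure ℝ) (h : ℝ → ℝ≥0∞) :
    Measurable (intervalMaximal μ h) :=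
  (lowerSemicontinuous_intervalMaximal μ h).measurable

theorem exists_Ioo_subset_biUnion_erase {G : Finset (ℝ × ℝ)} {x : ℝ}
    (hx : ∀ p ∈ G, x ∈ Set.Ioo p.1 p.2) (hG : 2 < G.card) :
    ∃ m ∈ G, Set.Ioo m.1 m.2 ⊆ ⋃ p ∈ G.erase m, Set.Ioo p.1 p.2 := by
  have hne : G.Nonempty := Finset.card_pos.1 (by lia)
  obtain ⟨l, hl, hl_min⟩ := G.exists_min_image Prod.fst hne
  obtain ⟨u, hu, hu_max⟩ := G.exists_max_image Prod.snd hne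
  obtain ⟨m, hm, hm_ne⟩ : ∃ m ∈ G, m ∉ ({l, u} : Finset (ℝ × ℝ)) :=
    Finset.exists_mem_notMem_of_card_lt_card (Finset.card_le_two.trans_lt hG)
  simp only [Finset.mem_insert, Finset.mem_singleton, not_or] at hm_ne
  refine ⟨m, hm, fun y hy => ?_⟩
  simp only [Set.mem_iUnion, exists_prop, Finset.mem_erase]
  rcases le_or_gt y x with hyx | hxy
  · exact ⟨l, ⟨Ne.symm hm_ne.1, hl⟩, (hl_min m hm).trans_lt hy.1, hyx.trans_lt (hx l hl).2⟩
  · exact ⟨u, ⟨Ne.symm hm_ne.2, hu⟩, (hx u hu).1.trans hxy, hy.2.trans_le (hu_max m hm)⟩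

theorem exists_subfamily_overlap_le_two (T : Finset (ℝ × ℝ)) :
    ∃ T' ⊆ T, (⋃ p ∈ T', Set.Ioo p.1 p.2) = ⋃ p ∈ T, Set.Ioo p.1 p.2 ∧
      ∀ x, (T'.filter fun p => x ∈ Set.Ioo p.1 p.2).card ≤ 2 := by
  classical
  obtain ⟨T', hT', hmin⟩ := (T.powerset.filter fun T' =>
    (⋃ p ∈ T', Set.Ioo p.1 p.2) = ⋃ p ∈ T, Set.Ioo p.1 p.2).exists_min_image Finset.card
      ⟨T, by simp⟩
  simp only [Finset.mem_filter, Finset.mem_powerset] at hT' hmin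
  refine ⟨T', hT'.1, hT'.2, fun x => ?_⟩
  by_contra! hcard
  obtain ⟨m, hm, hm_sub⟩ := exists_Ioo_subset_biUnion_erase
    (fun p hp => (Finset.mem_filter.1 hp).2) hcard
  have hmT' := (Finset.mem_filter.1 hm).1
  have hunion : (⋃ p ∈ T'.erase m, Set.Ioo p.1 p.2) = ⋃ p ∈ T', Set.Ioo p.1 p.2 := by
    refine (Set.biUnion_subset_biUnion_left (T'.erase_subset m)).antisymm
      (Set.iUnion₂_subset fun p hp => ?_)
    rcases eq_or_ne p m with rfl | hpm
    · exact hm_sub.trans (Set.biUnion_subset_biUnion_left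
        (Finset.erase_subset_erase _ (Finset.filter_subset _ _)))
    · exact Set.subset_biUnion_of_mem (u := fun p : ℝ × ℝ => Set.Ioo p.1 p.2)
        (Finset.mem_coe.2 (Finset.mem_erase.2 ⟨hpm, hp⟩))
  exact (Finset.card_erase_lt_of_mem hmT').not_ge
    (hmin _ ⟨(Finset.erase_subset _ _).trans hT'.1, hunion.trans hT'.2⟩)

variable (μ : Measure ℝ) {h : ℝ → ℝ≥0∞}

theorem mul_measure_biUnion_Ioo_le (hh : Measurable h) {t : ℝ≥0∞} {T : Finset (ℝ × ℝ)}
    (hT : ∀ p ∈ T, t * μ (Set.Ioo p.1 p.2) ≤ ∫⁻ y in Set.Ioo p.1 p.2, h y ∂μ) :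
    t * μ (⋃ p ∈ T, Set.Ioo p.1 p.2) ≤ 2 * ∫⁻ y, h y ∂μ := by
  classical
  obtain ⟨T', hsub, hunion, hoverlap⟩ := exists_subfamily_overlap_le_two T
  rw [← hunion]
  calc t * μ (⋃ p ∈ T', Set.Ioo p.1 p.2)
      ≤ t * ∑ p ∈ T', μ (Set.Ioo p.1 p.2) := by
        gcongr
        exact measure_biUnion_finset_le _ _
    _ ≤ ∑ p ∈ T', ∫⁻ y, (Set.Ioo p.1 p.2).indicator h y ∂μ := by
        rw [Finset.mul_sum]
        refine Finset.sum_le_sum fun p hp => ?_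
        rw [lintegral_indicator measurableSet_Ioo]
        exact hT p (hsub hp)
    _ = ∫⁻ y, ∑ p ∈ T', (Set.Ioo p.1 p.2).indicator h y ∂μ :=
        (lintegral_finsetSum _ fun p _ => hh.indicator measurableSet_Ioo).symm
    _ ≤ ∫⁻ y, 2 * h y ∂μ := by
        refine lintegral_mono fun y => ?_
        simp only [Set.indicator_apply]
        rw [← Finset.sum_filter, Finset.sum_const, nsmul_eq_mul]
        gcongr
        exact_mod_cast hoverlap y
    _ = 2 * ∫⁻ y, h y ∂μ := lintegral_const_mul _ hh

theorem setOf_lt_intervalMaximal_eq_biUnion (h : ℝ → ℝ≥0∞) (t : ℝ≥0∞) :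
    {x | t < intervalMaximal μ h x} =
      ⋃ p ∈ {p : ℝ × ℝ | t < ⨍⁻ y in Set.Ioo p.1 p.2, h y ∂μ}, Set.Ioo p.1 p.2 := by
  ext x
  simp only [intervalMaximal, lt_iSup_iff, Set.mem_ofPred_eq, Set.mem_iUnion, exists_prop,
    Prod.exists, and_comm]

theorem mul_measure_lt_intervalMaximal_le (hh : Measurable h) (t : ℝ≥0∞) :
    t * μ {x | t < intervalMaximal μ h x} ≤ 2 * ∫⁻ y, h y ∂μ := by
  classical
  let I : Set (ℝ × ℝ) := {p | t < ⨍⁻ y in Set.Ioo p.1 p.2, h y ∂μ}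
  have hI : ∀ p ∈ I, t * μ (Set.Ioo p.1 p.2) ≤ ∫⁻ y in Set.Ioo p.1 p.2, h y ∂μ := fun p hp =>
    ENNReal.mul_le_of_le_div (setLAverage_eq μ h _ ▸ le_of_lt hp)
  obtain ⟨J, hJI, hJ_count, hJ⟩ :=
    TopologicalSpace.isOpen_biUnion_countable I (fun p => Set.Ioo p.1 p.2) fun p _ => isOpen_Ioo
  have := hJ_count.to_subtype
  rw [setOf_lt_intervalMaximal_eq_biUnion, ← hJ, Set.biUnion_eq_iUnion, Set.iUnion_eq_iUnion_finset,
    Directed.measure_iUnion, ENNReal.mul_iSup]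
  · refine iSup_le fun F => ?_
    have hF : ∀ p ∈ F.image Subtype.val,
        t * μ (Set.Ioo p.1 p.2) ≤ ∫⁻ y in Set.Ioo p.1 p.2, h y ∂μ := fun p hp => by
      obtain ⟨p, -, rfl⟩ := Finset.mem_image.1 hp
      exact hI p (hJI p.2)
    simpa only [Finset.set_biUnion_finset_image] using mul_measure_biUnion_Ioo_le μ hh hF
  · exact directed_of_isDirected_le fun F G hFG =>
      Set.biUnion_subset_biUnion_left fun _ hx => Finset.mem_of_subset hFG hx

theorem intervalMaximal_le_add_indicator (h : ℝ → ℝ≥0∞) (c : ℝ≥0∞) (x : ℝ) :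
    intervalMaximal μ h x ≤ c + intervalMaximal μ ({y | c < h y}.indicator h) x := by
  refine iSup₂_le fun a b => iSup_le fun hx => ?_
  calc ⨍⁻ y in Set.Ioo a b, h y ∂μ
      ≤ ⨍⁻ y in Set.Ioo a b, (c + {y | c < h y}.indicator h y) ∂μ := by
        refine laverage_mono_ae (Filter.Eventually.of_forall fun y => ?_)
        by_cases hy : c < h y
        · simp [hy]
        · simpa [Set.indicator_apply, hy] using not_lt.1 hy
    _ = ⨍⁻ _ in Set.Ioo a b, c ∂μ + ⨍⁻ y in Set.Ioo a b, {y | c < h y}.indicator h y ∂μ := by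
        simp only [laverage_eq']
        exact lintegral_add_left measurable_const _
    _ ≤ c + intervalMaximal μ ({y | c < h y}.indicator h) x := by
        gcongr
        · exact (laverage_le_essSup _).trans (essSup_le_of_ae_le _ (by simp [Filter.EventuallyLE]))
        · exact laverage_le_intervalMaximal μ _ hx

/-- Only the part of `h` above `t / 2` matters, since the rest contributes at most `t / 2` to the
maximal function. -/
theorem mul_measure_lt_intervalMaximal_le_setLIntegral (hh : Measurable h) (t : ℝ≥0∞) :
    t * μ {x | t < intervalMaximal μ h x} ≤ 4 * ∫⁻ y in {y | t < 2 * h y}, h y ∂μ := by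
  have hset : {y | t < 2 * h y} = {y | t / 2 < h y} := by
    ext y
    simp only [Set.mem_ofPred_eq]
    rw [ENNReal.div_lt_iff (by simp) (by simp), mul_comm]
  have hmeas : MeasurableSet {y | t / 2 < h y} := measurableSet_lt measurable_const hh
  have hsub : {x | t < intervalMaximal μ h x} ⊆
      {x | t / 2 < intervalMaximal μ ({y | t / 2 < h y}.indicator h) x} := fun x hx => by
    by_contra hle
    have hle' := (intervalMaximal_le_add_indicator μ h (t / 2) x).trans
      (add_le_add_right (not_lt.1 hle) _)
    exact (hle'.trans (ENNReal.add_halves t).le).not_gt hx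
  calc t * μ {x | t < intervalMaximal μ h x}
      ≤ t * μ {x | t / 2 < intervalMaximal μ ({y | t / 2 < h y}.indicator h) x} := by gcongr
    _ = 2 * (t / 2 * μ {x | t / 2 < intervalMaximal μ ({y | t / 2 < h y}.indicator h) x}) := by
        rw [← mul_assoc, ENNReal.mul_div_cancel (by simp) (by simp)]
    _ ≤ 2 * (2 * ∫⁻ y, {y | t / 2 < h y}.indicator h y ∂μ) := by
        gcongr 2 * ?_
        exact mul_measure_lt_intervalMaximal_le μ (hh.indicator hmeas) _
    _ = 4 * ∫⁻ y in {y | t < 2 * h y}, h y ∂μ := by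
        rw [hset, lintegral_indicator hmeas, ← mul_assoc]
        norm_num

end IntervalMaximal

section Interpolation

variable {α : Type*} [MeasurableSpace α]

theorem lintegral_Ioi_ofReal_rpow (s : ℝ) :
    ∫⁻ t in Set.Ioi (0 : ℝ), ENNReal.ofReal (t ^ s) = ∞ := by
  by_contra h
  refine not_integrableOn_Ioi_rpow s ((lintegral_ofReal_ne_top_iff_integrable
    (by fun_prop) ?_).1 h)
  exact (ae_restrict_mem measurableSet_Ioi).mono fun t ht => Real.rpow_nonneg (le_of_lt ht) s

theorem lintegral_rpow_eq_lintegral_measure_ofReal_lt (μ : Measure α) {F : α → ℝ≥0∞}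
    (hF : AEMeasurable F μ) {p : ℝ} (hp : 0 < p) :
    ∫⁻ x, F x ^ p ∂μ = ENNReal.ofReal p *
      ∫⁻ t in Set.Ioi (0 : ℝ), μ {x | ENNReal.ofReal t < F x} * ENNReal.ofReal (t ^ (p - 1)) := by
  by_cases hfin : ∀ᵐ x ∂μ, F x ≠ ∞
  · have hcake := lintegral_rpow_eq_lintegral_meas_lt_mul μ (f := fun x => (F x).toReal)
      (Filter.Eventually.of_forall fun _ => ENNReal.toReal_nonneg) hF.ennreal_toReal hp
    have hleft : ∫⁻ x, F x ^ p ∂μ = ∫⁻ x, ENNReal.ofReal ((F x).toReal ^ p) ∂μ :=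
      lintegral_congr_ae (hfin.mono fun x hx => by
        simp only [← ENNReal.ofReal_rpow_of_nonneg ENNReal.toReal_nonneg hp.le,
          ENNReal.ofReal_toReal hx])
    rw [hleft, hcake]
    congr 1
    refine setLIntegral_congr_fun measurableSet_Ioi fun t ht => ?_
    congr 1
    exact measure_congr (Filter.eventuallyEq_set.2 (hfin.mono fun x hx =>
      (ENNReal.ofReal_lt_iff_lt_toReal (le_of_lt ht) hx).symm))
  · have hpos : μ {x | F x = ∞} ≠ 0 := fun h => hfin (by simpa [ae_iff] using h)
    have hleft : ∫⁻ x, F x ^ p ∂μ = ∞ :=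
      lintegral_eq_top_of_measure_eq_top_ne_zero (hF.pow_const p)
        (by simpa [ENNReal.rpow_eq_top_iff_of_pos hp] using hpos)
    have hright : ∫⁻ t in Set.Ioi (0 : ℝ), μ {x | F x = ∞} * ENNReal.ofReal (t ^ (p - 1)) ≤
        ∫⁻ t in Set.Ioi (0 : ℝ),
          μ {x | ENNReal.ofReal t < F x} * ENNReal.ofReal (t ^ (p - 1)) := by
      gcongr with t x
      rintro hx
      simp [hx]
    rw [lintegral_const_mul _ (by fun_prop), lintegral_Ioi_ofReal_rpow, ENNReal.mul_top hpos,
      top_le_iff] at hright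
    rw [hleft, hright, ENNReal.mul_top (by simpa using hp)]

theorem lintegral_mul_rpow_withDensity_self (μ : Measure α) {h : α → ℝ≥0∞} (hh : Measurable h)
    (c : ℝ≥0∞) {p : ℝ} (hp : 1 ≤ p) :
    ∫⁻ x, (c * h x) ^ (p - 1) ∂(μ.withDensity h) = c ^ (p - 1) * ∫⁻ x, h x ^ p ∂μ := by
  have hp₁ : 0 ≤ p - 1 := sub_nonneg.2 hp
  rw [lintegral_withDensity_eq_lintegral_mul _ hh (by fun_prop),
    ← lintegral_const_mul _ (by fun_prop)]
  refine lintegral_congr fun x => ?_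
  have hsplit : h x ^ p = h x * h x ^ (p - 1) := by
    conv_lhs => rw [← add_sub_cancel 1 p, ENNReal.rpow_add_of_nonneg _ _ zero_le_one hp₁,
      ENNReal.rpow_one]
  rw [Pi.mul_apply, ENNReal.mul_rpow_of_nonneg _ _ hp₁, hsplit, mul_left_comm]

/-- Marcinkiewicz interpolation between the given truncated weak type bound and `L^∞`: the layer
cake formula is used once for `F` with `μ` and once for `h` with `h dμ`. -/
theorem lintegral_rpow_le_of_mul_measure_lt_le {μ : Measure α} {F h : α → ℝ≥0∞}
    (hF : Measurable F) (hh : Measurable h) {c : ℝ≥0}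
    (hweak : ∀ t, t * μ {x | t < F x} ≤ c * ∫⁻ y in {y | t < 2 * h y}, h y ∂μ)
    {p : ℝ} (hp : 1 < p) :
    ∫⁻ x, F x ^ p ∂μ ≤
      ENNReal.ofReal p * c * (ENNReal.ofReal (p - 1))⁻¹ * 2 ^ (p - 1) * ∫⁻ x, h x ^ p ∂μ := by
  have hp₁ : 0 < p - 1 := sub_pos.2 hp
  have hcake := lintegral_rpow_eq_lintegral_measure_ofReal_lt (μ.withDensity h)
    (F := fun y => 2 * h y) (by fun_prop) hp₁
  rw [lintegral_mul_rpow_withDensity_self μ hh 2 hp.le] at hcake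
  have hlevel : ∀ t ∈ Set.Ioi (0 : ℝ),
      μ {x | ENNReal.ofReal t < F x} * ENNReal.ofReal (t ^ (p - 1)) ≤
        c * (μ.withDensity h {y | ENNReal.ofReal t < 2 * h y} *
          ENNReal.ofReal (t ^ (p - 1 - 1))) := fun t ht => by
    rw [withDensity_apply _ (measurableSet_lt measurable_const (by fun_prop)), ← mul_assoc,
      show t ^ (p - 1) = t * t ^ (p - 1 - 1) by
        rw [Real.rpow_sub_one (ne_of_gt ht) (p - 1), mul_div_cancel₀ _ (ne_of_gt ht)],
      ENNReal.ofReal_mul (le_of_lt ht), ← mul_assoc, mul_comm (μ _)]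
    gcongr ?_ * _
    exact hweak _
  calc ∫⁻ x, F x ^ p ∂μ
      = ENNReal.ofReal p * ∫⁻ t in Set.Ioi (0 : ℝ),
          μ {x | ENNReal.ofReal t < F x} * ENNReal.ofReal (t ^ (p - 1)) :=
        lintegral_rpow_eq_lintegral_measure_ofReal_lt μ hF.aemeasurable (one_pos.trans hp)
    _ ≤ ENNReal.ofReal p * ∫⁻ t in Set.Ioi (0 : ℝ), c *
          (μ.withDensity h {y | ENNReal.ofReal t < 2 * h y} *
            ENNReal.ofReal (t ^ (p - 1 - 1))) := by
        gcongr _ * ?_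
        exact setLIntegral_mono' measurableSet_Ioi hlevel
    _ = ENNReal.ofReal p * (c * ((ENNReal.ofReal (p - 1))⁻¹ *
          (2 ^ (p - 1) * ∫⁻ x, h x ^ p ∂μ))) := by
        rw [lintegral_const_mul' _ _ ENNReal.coe_ne_top, hcake,
          ENNReal.inv_mul_cancel_left (by simpa using hp) ENNReal.ofReal_ne_top]
    _ = _ := by ring

end Interpolation

section MaximalTheorem

theorem exists_eLpNorm_intervalMaximal_le {p : ℝ≥0∞} (hp : 1 < p) :
    ∃ C : ℝ≥0, ∀ (μ : Measure ℝ) (h : ℝ → ℝ≥0∞), Measurable h →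
      eLpNorm (intervalMaximal μ h) p μ ≤ C * eLpNorm h p μ := by
  rcases eq_or_ne p ∞ with rfl | hp_top
  · refine ⟨1, fun μ h _ => ?_⟩
    rw [ENNReal.coe_one, one_mul, eLpNorm_exponent_top, eLpNorm_exponent_top]
    exact essSup_le_of_ae_le _ (Filter.Eventually.of_forall (intervalMaximal_le_essSup μ h))
  have hp₀ : p ≠ 0 := (zero_lt_one.trans hp).ne'
  have hp_real : 1 < p.toReal := by simpa using ENNReal.toReal_strict_mono hp_top hp
  let K : ℝ≥0∞ := ENNReal.ofReal p.toReal * (4 : ℝ≥0) * (ENNReal.ofReal (p.toReal - 1))⁻¹ *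
    2 ^ (p.toReal - 1)
  have hK : K ^ (1 / p.toReal) ≠ ∞ := by
    have hinv : (ENNReal.ofReal (p.toReal - 1))⁻¹ ≠ ∞ := by simpa using hp_real
    have hpow : (2 : ℝ≥0∞) ^ (p.toReal - 1) ≠ ∞ :=
      ENNReal.rpow_ne_top_of_nonneg (sub_nonneg.2 hp_real.le) (by simp)
    exact ENNReal.rpow_ne_top_of_nonneg (by positivity) (by finiteness)
  refine ⟨(K ^ (1 / p.toReal)).toNNReal, fun μ h hh => ?_⟩
  rw [ENNReal.coe_toNNReal hK, eLpNorm_eq_lintegral_rpow_enorm_toReal hp₀ hp_top,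
    eLpNorm_eq_lintegral_rpow_enorm_toReal hp₀ hp_top,
    ← ENNReal.mul_rpow_of_nonneg _ _ (by positivity)]
  gcongr
  exact lintegral_rpow_le_of_mul_measure_lt_le (measurable_intervalMaximal μ h) hh
    (mul_measure_lt_intervalMaximal_le_setLIntegral μ hh) hp_real

theorem exists_eLpNorm_intervalMaximal_rpow_le {S : ℝ} (hS : 0 < S) {q : ℝ≥0∞}
    (hqS : 1 < q * ENNReal.ofReal S) :
    ∃ C : ℝ≥0, ∀ (μ : Measure ℝ) (h : ℝ → ℝ≥0∞), Measurable h →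
      eLpNorm (fun x => intervalMaximal μ h x ^ S) q μ ≤ C * eLpNorm (fun x => h x ^ S) q μ := by
  obtain ⟨C, hC⟩ := exists_eLpNorm_intervalMaximal_le hqS
  refine ⟨C ^ S, fun μ h hh => ?_⟩
  have hpow (F : ℝ → ℝ≥0∞) :
      eLpNorm (fun x => F x ^ S) q μ = eLpNorm F (q * ENNReal.ofReal S) μ ^ S :=
    eLpNorm_enorm_rpow F hS
  rw [hpow, hpow, ENNReal.coe_rpow_of_nonneg _ hS.le, ← ENNReal.mul_rpow_of_nonneg _ _ hS.le]
  gcongr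
  exact hC μ h hh

end MaximalTheorem

section RegularWeight

variable {α : Type*} [MeasurableSpace α]

/-- A measurable density whose values are positive and finite at every point, so that arbitrary real
powers of it can be manipulated pointwise. Every a.e. positive, a.e. measurable real function has
such a representative. -/
structure IsRegularWeight (W : α → ℝ≥0∞) : Prop where
  measurable : Measurable W
  ne_zero (x : α) : W x ≠ 0
  ne_top (x : α) : W x ≠ ∞

namespace IsRegularWeight

variable {W : α → ℝ≥0∞}

theorem rpow (hW : IsRegularWeight W) (c : ℝ) : IsRegularWeight fun x => W x ^ c where
  measurable := hW.measurable.pow_const c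
  ne_zero x := (ENNReal.rpow_pos (pos_iff_ne_zero.2 (hW.ne_zero x)) (hW.ne_top x)).ne'
  ne_top x := ENNReal.rpow_ne_top_of_ne_zero (hW.ne_zero x) (hW.ne_top x)

theorem finset_prod {ι : Type*} (s : Finset ι) {W : ι → α → ℝ≥0∞}
    (hW : ∀ i, IsRegularWeight (W i)) : IsRegularWeight fun x => ∏ i ∈ s, W i x where
  measurable := Finset.measurable_fun_prod _ fun i _ => (hW i).measurable
  ne_zero x := Finset.prod_ne_zero_iff.2 fun i _ => (hW i).ne_zero x
  ne_top x := ENNReal.prod_ne_top fun i _ => (hW i).ne_top x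

theorem min_const (hW : IsRegularWeight W) {c : ℝ≥0∞} (hc₀ : c ≠ 0) (hc : c ≠ ∞) :
    IsRegularWeight fun x => min (W x) c where
  measurable := hW.measurable.min measurable_const
  ne_zero x := (lt_min (pos_iff_ne_zero.2 (hW.ne_zero x)) (pos_iff_ne_zero.2 hc₀)).ne'
  ne_top _ := ne_top_of_le_ne_top hc (min_le_right _ _)

theorem ae_withDensity_eq (hW : IsRegularWeight W) (μ : Measure α) :
    ae (μ.withDensity W) = ae μ :=
  le_antisymm (withDensity_absolutelyContinuous μ W).ae_le
    (withDensity_absolutelyContinuous' hW.measurable.aemeasurable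
      (Filter.Eventually.of_forall hW.ne_zero)).ae_le

theorem eLpNorm_withDensity {ε : Type*} [TopologicalSpace ε] [ContinuousENorm ε]
    (hW : IsRegularWeight W) (μ : Measure α) {q : ℝ≥0∞} (hq : q ≠ 0) (f : α → ε) :
    eLpNorm f q (μ.withDensity W) =
      eLpNorm (fun x => ‖f x‖ₑ * W x ^ (q⁻¹).toReal) q μ := by
  rcases eq_or_ne q ∞ with rfl | hq_top
  · simp only [eLpNorm_exponent_top, eLpNormEssSup, essSup, hW.ae_withDensity_eq, ENNReal.inv_top,
      ENNReal.toReal_zero, ENNReal.rpow_zero, mul_one, enorm_eq_self]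
  · have hq_pos : 0 < q.toReal := ENNReal.toReal_pos hq hq_top
    rw [eLpNorm_eq_lintegral_rpow_enorm_toReal hq hq_top,
      eLpNorm_eq_lintegral_rpow_enorm_toReal hq hq_top,
      lintegral_withDensity_eq_lintegral_mul_non_measurable _ hW.measurable
        (Filter.Eventually.of_forall fun x => (hW.ne_top x).lt_top)]
    congr 1
    refine lintegral_congr fun x => ?_
    rw [Pi.mul_apply, enorm_eq_self, ENNReal.mul_rpow_of_nonneg _ _ hq_pos.le, ← ENNReal.rpow_mul,
      ENNReal.toReal_inv, inv_mul_cancel₀ hq_pos.ne', ENNReal.rpow_one, mul_comm]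

theorem setLIntegral_ne_zero (hW : IsRegularWeight W) {μ : Measure α} {s : Set α} (hs : μ s ≠ 0) :
    ∫⁻ x in s, W x ∂μ ≠ 0 := by
  have hsupp : Function.support W = Set.univ := Set.eq_univ_of_forall hW.ne_zero
  rw [← pos_iff_ne_zero, lintegral_pos_iff_support hW.measurable, hsupp,
    Measure.restrict_apply_univ]
  exact pos_iff_ne_zero.2 hs

theorem setLAverage_Ioo_ne_zero {W : ℝ → ℝ≥0∞} (hW : IsRegularWeight W) {a b : ℝ} (hab : a < b) :
    ⨍⁻ x in Set.Ioo a b, W x ∂volume ≠ 0 := by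
  rw [setLAverage_eq]
  exact ENNReal.div_ne_zero.2 ⟨hW.setLIntegral_ne_zero (by simp [hab]), by simp⟩

theorem laverage_mul_laverage_withDensity (hW : IsRegularWeight W) (μ : Measure α)
    {h : α → ℝ≥0∞} (hh : Measurable h) {s : Set α} (hs : MeasurableSet s) (hμs : μ s ≠ 0)
    (htop : ∫⁻ x in s, W x ∂μ ≠ ∞) :
    (⨍⁻ x in s, W x ∂μ) * ⨍⁻ x in s, h x ∂(μ.withDensity W) = ⨍⁻ x in s, W x * h x ∂μ := by
  rw [setLAverage_eq, setLAverage_eq, setLAverage_eq, withDensity_apply _ hs,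
    setLIntegral_withDensity_eq_setLIntegral_mul μ hW.measurable hh hs,
    ENNReal.div_eq_inv_mul, ENNReal.div_eq_inv_mul, ENNReal.div_eq_inv_mul, mul_assoc,
    ENNReal.mul_inv_cancel_left (hW.setLIntegral_ne_zero hμs) htop]
  rfl

end IsRegularWeight

end RegularWeight

section Holder

variable {α : Type*} [MeasurableSpace α] {μ : Measure α}

theorem eLpNorm_mul_le_eLpNorm_top_mul (p : ℝ≥0∞) (F : α → ℝ≥0∞) {G : α → ℝ≥0∞}
    (hG : AEMeasurable G μ) :
    eLpNorm (fun x => F x * G x) p μ ≤ eLpNorm F ∞ μ * eLpNorm G p μ := by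
  have hF : ∀ᵐ x ∂μ, F x ≤ eLpNorm F ∞ μ := ae_le_eLpNormEssSup
  have hmono : eLpNorm (fun x => F x * G x) p μ ≤ eLpNorm (fun x => eLpNorm F ∞ μ * G x) p μ :=
    eLpNorm_mono_enorm_ae (hF.mono fun x hx => mul_le_mul_left hx (G x))
  refine hmono.trans ?_
  obtain rfl | rfl | hp := ENNReal.trichotomy p
  · simp only [eLpNorm_exponent_zero, mul_zero, le_refl]
  · exact (ENNReal.essSup_const_mul (f := G)).le
  obtain ⟨hp₀, hp_top⟩ := ENNReal.toReal_pos_iff.1 hp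
  simp only [eLpNorm_eq_lintegral_rpow_enorm_toReal hp₀.ne' hp_top.ne, enorm_eq_self,
    ENNReal.mul_rpow_of_nonneg _ _ hp.le]
  rw [lintegral_const_mul'' _ (hG.pow_const _), ENNReal.mul_rpow_of_nonneg _ _ (by positivity),
    ← ENNReal.rpow_mul, mul_one_div_cancel hp.ne', ENNReal.rpow_one]

theorem eLpNorm_top_finset_prod_le {ι : Type*} (s : Finset ι) (F : ι → α → ℝ≥0∞) :
    eLpNorm (fun x => ∏ i ∈ s, F i x) ∞ μ ≤ ∏ i ∈ s, eLpNorm (F i) ∞ μ := by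
  have hF : ∀ᵐ x ∂μ, ∀ i ∈ s, F i x ≤ eLpNorm (F i) ∞ μ :=
    (Finset.eventually_all s).2 fun i _ => ae_le_eLpNormEssSup
  rw [eLpNorm_exponent_top]
  exact essSup_le_of_ae_le _ (hF.mono fun x hx => Finset.prod_le_prod' hx)

theorem eLpNorm_finset_prod_le_of_ne_top {ι : Type*} (s : Finset ι) {F : ι → α → ℝ≥0∞}
    (hF : ∀ i, AEMeasurable (F i) μ) {q : ι → ℝ≥0∞} (hq : ∀ i ∈ s, q i ≠ 0)
    (hq_top : ∀ i ∈ s, q i ≠ ∞) :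
    eLpNorm (fun x => ∏ i ∈ s, F i x) (∑ i ∈ s, (q i)⁻¹)⁻¹ μ ≤
      ∏ i ∈ s, eLpNorm (F i) (q i) μ := by
  rcases s.eq_empty_or_nonempty with rfl | hs
  · simpa using eLpNorm_top_finset_prod_le (μ := μ) ∅ F
  have hpos (i) (hi : i ∈ s) : 0 < (q i).toReal := ENNReal.toReal_pos (hq i hi) (hq_top i hi)
  set R := ∑ i ∈ s, (q i).toReal⁻¹ with hR_def
  have hR : 0 < R := Finset.sum_pos (fun i hi => inv_pos.2 (hpos i hi)) hs
  have hsum : (∑ i ∈ s, (q i)⁻¹)⁻¹.toReal = R⁻¹ := by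
    rw [ENNReal.toReal_inv, ENNReal.toReal_sum fun i hi => ENNReal.inv_ne_top.2 (hq i hi)]
    simp only [ENNReal.toReal_inv, hR_def]
  have hsplit (x : α) :
      (∏ i ∈ s, F i x) ^ R⁻¹ = ∏ i ∈ s, (F i x ^ (q i).toReal) ^ ((q i).toReal⁻¹ / R) := by
    rw [← ENNReal.prod_rpow_of_nonneg (inv_nonneg.2 hR.le)]
    refine Finset.prod_congr rfl fun i hi => ?_
    rw [← ENNReal.rpow_mul, ← mul_div_assoc, mul_inv_cancel₀ (hpos i hi).ne', one_div]
  have hholder := ENNReal.lintegral_prod_norm_pow_le (μ := μ) s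
    (f := fun i x => F i x ^ (q i).toReal) (fun i _ => (hF i).pow_const _)
    (p := fun i => (q i).toReal⁻¹ / R) (by rw [← Finset.sum_div, div_self hR.ne'])
    fun i hi => div_nonneg (inv_nonneg.2 (hpos i hi).le) hR.le
  obtain ⟨hr, hr_top⟩ := ENNReal.toReal_pos_iff.1 (hsum ▸ inv_pos.2 hR)
  rw [eLpNorm_eq_lintegral_rpow_enorm_toReal hr.ne' hr_top.ne, hsum, one_div, inv_inv]
  simp only [enorm_eq_self, hsplit]
  refine (ENNReal.rpow_le_rpow hholder hR.le).trans_eq ?_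
  rw [← ENNReal.prod_rpow_of_nonneg hR.le]
  refine Finset.prod_congr rfl fun i hi => ?_
  rw [← ENNReal.rpow_mul, div_mul_cancel₀ _ hR.ne',
    eLpNorm_eq_lintegral_rpow_enorm_toReal (hq i hi) (hq_top i hi), one_div]
  simp only [enorm_eq_self]

theorem eLpNorm_finset_prod_le {ι : Type*} (s : Finset ι) {F : ι → α → ℝ≥0∞}
    (hF : ∀ i, AEMeasurable (F i) μ) {q : ι → ℝ≥0∞} (hq : ∀ i ∈ s, q i ≠ 0) :
    eLpNorm (fun x => ∏ i ∈ s, F i x) (∑ i ∈ s, (q i)⁻¹)⁻¹ μ ≤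
      ∏ i ∈ s, eLpNorm (F i) (q i) μ := by
  classical
  have hsum : ∑ i ∈ s, (q i)⁻¹ = ∑ i ∈ s with q i ≠ ∞, (q i)⁻¹ :=
    (Finset.sum_filter_of_ne (p := fun i => q i ≠ ∞) fun i _ hi h =>
      hi (by rw [h, ENNReal.inv_top])).symm
  have htop : ∏ i ∈ s with q i = ∞, eLpNorm (F i) ∞ μ =
      ∏ i ∈ s with q i = ∞, eLpNorm (F i) (q i) μ :=
    Finset.prod_congr rfl fun i hi => by rw [(Finset.mem_filter.1 hi).2]
  simp only [← Finset.prod_filter_mul_prod_filter_not s (fun i => q i = ∞)]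
  rw [hsum, ← htop]
  refine (eLpNorm_mul_le_eLpNorm_top_mul _ _
    (Finset.aemeasurable_fun_prod _ fun i _ => hF i)).trans ?_
  gcongr
  · exact eLpNorm_top_finset_prod_le _ F
  · exact eLpNorm_finset_prod_le_of_ne_top _ hF (fun i hi => hq i (Finset.mem_filter.1 hi).1)
      fun i hi => (Finset.mem_filter.1 hi).2

end Holder

section Exponents

variable {ι : Type*} [Fintype ι] {q : ι → ℝ≥0∞} {q₀ : ℝ≥0∞}

theorem ne_zero_of_inv_eq_sum_inv (hq : q₀⁻¹ = ∑ j, (q j)⁻¹) (hq_ne : ∀ j, q j ≠ 0) : q₀ ≠ 0 :=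
  ENNReal.inv_ne_top.1 (hq ▸ ENNReal.sum_ne_top.2 fun j _ => ENNReal.inv_ne_top.2 (hq_ne j))

theorem le_of_inv_eq_sum_inv (hq : q₀⁻¹ = ∑ j, (q j)⁻¹) (j : ι) : q₀ ≤ q j :=
  ENNReal.inv_le_inv.1
    (hq ▸ Finset.single_le_sum_of_canonicallyOrdered (f := fun j => (q j)⁻¹) (Finset.mem_univ j))

end Exponents

section PowerBounds

variable {ι : Type*}

theorem ennreal_rpow_sum {x : ℝ≥0∞} (hx : x ≠ 0) (hx' : x ≠ ∞) (s : Finset ι) (c : ι → ℝ) :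
    x ^ (∑ i ∈ s, c i) = ∏ i ∈ s, x ^ c i := by
  induction s using Finset.cons_induction with
  | empty => simp
  | cons i s hi ih => rw [Finset.sum_cons, Finset.prod_cons, ENNReal.rpow_add _ _ hx hx', ih]

theorem ennreal_tendsto_finset_prod_of_ne_zero {α : Type*} {l : Filter α} (s : Finset ι)
    {f : ι → α → ℝ≥0∞} {c : ι → ℝ≥0∞} (hf : ∀ i, Filter.Tendsto (f i) l (nhds (c i)))
    (hc : ∀ i, c i ≠ 0) :
    Filter.Tendsto (fun x => ∏ i ∈ s, f i x) l (nhds (∏ i ∈ s, c i)) := by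
  induction s using Finset.cons_induction with
  | empty => simp only [Finset.prod_empty, tendsto_const_nhds]
  | cons i s hi ih =>
    simp only [Finset.prod_cons]
    exact ENNReal.Tendsto.mul (hf i) (Or.inl (hc i)) ih
      (Or.inl (Finset.prod_ne_zero_iff.2 fun j _ => hc j))

theorem one_le_laverage_rpow_mul_prod [Fintype ι] {α : Type*} [MeasurableSpace α]
    (μ : Measure α) [IsFiniteMeasure μ] [NeZero μ] {σ : ι → α → ℝ≥0∞}
    (hσ : ∀ j, IsRegularWeight (σ j)) {θ : ℝ} (hθ : 0 < θ) {b : ι → ℝ} (hb : ∀ j, 0 ≤ b j) :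
    1 ≤ (⨍⁻ x, (∏ j, σ j x ^ (-b j)) ^ (1 / θ) ∂μ) ^ θ * ∏ j, (⨍⁻ x, σ j x ∂μ) ^ b j := by
  have ht : 0 < θ + ∑ j, b j := add_pos_of_pos_of_nonneg hθ (Finset.sum_nonneg fun j _ => hb j)
  set t := θ + ∑ j, b j
  have hcancel (x : α) :
      ((∏ j, σ j x ^ (-b j)) ^ (1 / θ)) ^ (θ / t) * ∏ j, σ j x ^ (b j / t) = 1 := by
    rw [← ENNReal.rpow_mul, one_div_mul_eq_div, div_div_cancel_left' hθ.ne',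
      ← ENNReal.prod_rpow_of_nonneg (by positivity), ← Finset.prod_mul_distrib]
    refine Finset.prod_eq_one fun j _ => ?_
    rw [← ENNReal.rpow_mul, ← ENNReal.rpow_add _ _ ((hσ j).ne_zero x) ((hσ j).ne_top x),
      neg_mul, ← div_eq_mul_inv, neg_add_cancel, ENNReal.rpow_zero]
  have hholder : 1 ≤ (⨍⁻ x, (∏ j, σ j x ^ (-b j)) ^ (1 / θ) ∂μ) ^ (θ / t) *
      ∏ j, (⨍⁻ x, σ j x ∂μ) ^ (b j / t) := by
    have h := ENNReal.lintegral_mul_prod_norm_pow_le (μ := (μ Set.univ)⁻¹ • μ) Finset.univ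
      (g := fun x => (∏ j, σ j x ^ (-b j)) ^ (1 / θ))
      ((Finset.measurable_fun_prod _ fun j _ =>
        (hσ j).measurable.pow_const _).pow_const _).aemeasurable
      (fun j _ => (hσ j).measurable.aemeasurable) (θ / t) (p := fun j => b j / t)
      (by rw [← Finset.sum_div, ← add_div, div_self ht.ne'])
      (by positivity) (fun j _ => div_nonneg (hb j) ht.le)
    simpa only [laverage, hcancel, lintegral_one, measure_univ] using h
  have hpow := ENNReal.rpow_le_rpow hholder ht.le
  rw [ENNReal.one_rpow, ENNReal.mul_rpow_of_nonneg _ _ ht.le,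
    ← ENNReal.prod_rpow_of_nonneg ht.le] at hpow
  simpa only [← ENNReal.rpow_mul, div_mul_cancel₀ _ ht.ne'] using hpow

theorem prod_rpow_le_of_rpow_mul_prod_le [Fintype ι] {A : ι → ℝ≥0∞} {V Z K : ℝ≥0∞}
    (hA₀ : ∀ j, A j ≠ 0) (hA : ∀ j, A j ≠ ∞) (hV₀ : V ≠ 0) (hV : V ≠ ∞) {S a : ι → ℝ} {R γ : ℝ}
    (hR : 0 ≤ R) (hγ : 0 ≤ γ) (hK : V ^ R * ∏ j, A j ^ a j ≤ K)
    (hZ : 1 ≤ Z ^ (γ * R) * ∏ j, A j ^ (γ * a j - S j)) :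
    ∏ j, A j ^ S j ≤ K ^ γ * (V⁻¹ * Z) ^ (γ * R) := by
  have hθ : 0 ≤ γ * R := mul_nonneg hγ hR
  have hsplit : (V ^ R * ∏ j, A j ^ a j) ^ γ =
      V ^ (γ * R) * (∏ j, A j ^ (γ * a j - S j)) * ∏ j, A j ^ S j := by
    rw [ENNReal.mul_rpow_of_nonneg _ _ hγ, ← ENNReal.rpow_mul, mul_comm R,
      ← ENNReal.prod_rpow_of_nonneg hγ, mul_assoc, ← Finset.prod_mul_distrib]
    congr 1
    refine Finset.prod_congr rfl fun j _ => ?_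
    rw [← ENNReal.rpow_mul, ← ENNReal.rpow_add _ _ (hA₀ j) (hA j), sub_add_cancel, mul_comm]
  have hVV : (V⁻¹ * Z) ^ (γ * R) * V ^ (γ * R) = Z ^ (γ * R) := by
    rw [← ENNReal.mul_rpow_of_nonneg _ _ hθ, mul_right_comm, ENNReal.inv_mul_cancel hV₀ hV,
      one_mul]
  calc ∏ j, A j ^ S j ≤ Z ^ (γ * R) * (∏ j, A j ^ (γ * a j - S j)) * ∏ j, A j ^ S j :=
        le_mul_of_one_le_left' hZ
    _ = (V ^ R * ∏ j, A j ^ a j) ^ γ * (V⁻¹ * Z) ^ (γ * R) := by rw [hsplit, ← hVV]; ring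
    _ ≤ K ^ γ * (V⁻¹ * Z) ^ (γ * R) := by gcongr

theorem exists_one_lt_and_le_mul_sub [Finite ι] {S r : ι → ℝ} (hr : ∀ j, 0 ≤ r j)
    (hrS : ∀ j, r j < S j) : ∃ γ : ℝ, 1 < γ ∧ ∀ j, S j ≤ γ * (S j - r j) := by
  have := Fintype.ofFinite ι
  have hS (j : ι) : 0 ≤ S j / (S j - r j) :=
    div_nonneg ((hr j).trans (hrS j).le) (sub_nonneg.2 (hrS j).le)
  refine ⟨2 + ∑ j, S j / (S j - r j), ?_, fun j => ?_⟩
  · linarith [Finset.sum_nonneg fun j (_ : j ∈ Finset.univ) => hS j]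
  · rw [← div_le_iff₀ (sub_pos.2 (hrS j))]
    linarith [Finset.single_le_sum (fun i _ => hS i) (Finset.mem_univ j)]

end PowerBounds

section WeightedMaximal

/-- The maximal function of the measure `W dx` applied to the density of `g dx` with respect to
`W dx`; dividing by `W` here lets averages of `g` itself be compared with it. -/
noncomputable def weightedMaximal (W g : ℝ → ℝ≥0∞) : ℝ → ℝ≥0∞ :=
  intervalMaximal (volume.withDensity W) fun x => (W x)⁻¹ * g x

theorem measurable_weightedMaximal (W g : ℝ → ℝ≥0∞) : Measurable (weightedMaximal W g) :=
  measurable_intervalMaximal _ _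

variable {W g : ℝ → ℝ≥0∞}

theorem setLAverage_le_mul_weightedMaximal (hW : IsRegularWeight W) (hg : Measurable g)
    {l u x : ℝ} (hx : x ∈ Set.Ioo l u) (htop : ⨍⁻ y in Set.Ioo l u, W y ∂volume ≠ ∞) :
    ⨍⁻ y in Set.Ioo l u, g y ∂volume ≤
      (⨍⁻ y in Set.Ioo l u, W y ∂volume) * weightedMaximal W g x := by
  have hint : ∫⁻ y in Set.Ioo l u, W y ≠ ∞ := by
    rw [← measure_mul_setLAverage _ (by simp)]
    exact ENNReal.mul_ne_top (by simp) htop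
  calc ⨍⁻ y in Set.Ioo l u, g y ∂volume
      = ⨍⁻ y in Set.Ioo l u, W y * ((W y)⁻¹ * g y) ∂volume := by
        simp only [ENNReal.mul_inv_cancel_left (hW.ne_zero _) (hW.ne_top _)]
    _ = (⨍⁻ y in Set.Ioo l u, W y ∂volume) *
          ⨍⁻ y in Set.Ioo l u, (W y)⁻¹ * g y ∂(volume.withDensity W) :=
        (hW.laverage_mul_laverage_withDensity volume (hW.measurable.inv.mul hg)
          measurableSet_Ioo (by simp [hx.1.trans hx.2]) hint).symm
    _ ≤ (⨍⁻ y in Set.Ioo l u, W y ∂volume) * weightedMaximal W g x := by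
        gcongr
        exact laverage_le_intervalMaximal _ _ hx

theorem one_lt_mul_ofReal_of_toReal_inv_lt {q : ℝ≥0∞} (hq : q ≠ 0) {S : ℝ}
    (hS : (q⁻¹).toReal < S) :
    1 < q * ENNReal.ofReal S := by
  rcases eq_or_ne q ∞ with rfl | hq_top
  · simp_all
  · rw [← ENNReal.mul_inv_cancel hq hq_top]
    gcongr
    exact (ENNReal.lt_ofReal_iff_toReal_lt (ENNReal.inv_ne_top.2 hq)).2 hS

theorem exists_eLpNorm_weightedMaximal_rpow_mul_le {q : ℝ≥0∞} (hq : q ≠ 0) {S : ℝ}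
    (hS : (q⁻¹).toReal < S) :
    ∃ C : ℝ≥0, ∀ W g : ℝ → ℝ≥0∞, IsRegularWeight W → Measurable g →
      eLpNorm (fun x => weightedMaximal W g x ^ S * W x ^ (q⁻¹).toReal) q volume ≤
        C * eLpNorm (fun x => g x ^ S * W x ^ ((q⁻¹).toReal - S)) q volume := by
  have hS₀ : 0 < S := ENNReal.toReal_nonneg.trans_lt hS
  obtain ⟨C, hC⟩ :=
    exists_eLpNorm_intervalMaximal_rpow_le hS₀ (one_lt_mul_ofReal_of_toReal_inv_lt hq hS)
  refine ⟨C, fun W g hW hg => ?_⟩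
  have h := hC (volume.withDensity W) (fun x => (W x)⁻¹ * g x) (hW.measurable.inv.mul hg)
  rw [hW.eLpNorm_withDensity _ hq, hW.eLpNorm_withDensity _ hq] at h
  have hdensity (x : ℝ) : ((W x)⁻¹ * g x) ^ S * W x ^ (q⁻¹).toReal =
      g x ^ S * W x ^ ((q⁻¹).toReal - S) := by
    rw [ENNReal.mul_rpow_of_nonneg _ _ hS₀.le, ENNReal.inv_rpow, ← ENNReal.rpow_neg,
      sub_eq_neg_add, ENNReal.rpow_add _ _ (hW.ne_zero x) (hW.ne_top x)]
    ring
  simp only [enorm_eq_self, hdensity] at h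
  exact h

end WeightedMaximal

section Multilinear

variable {ι : Type*} [Fintype ι]

/-- The multilinear maximal function of nonnegative densities. The operator `M_{s₁, …, sₙ}` is
recovered with `S j = 1 / s j` and `g j = |f j| ^ s j`. -/
noncomputable def multilinearMaximal (S : ι → ℝ) (g : ι → ℝ → ℝ≥0∞) (x : ℝ) : ℝ≥0∞ :=
  ⨆ (l : ℝ) (u : ℝ) (_ : x ∈ Set.Ioo l u), ∏ j, (⨍⁻ y in Set.Ioo l u, g j y ∂volume) ^ S j

/-- The quantity whose supremum over all intervals `(l, u)` is the characteristic of a vector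
weight, as a function of the joint weight `ν` and of the dual weights `σ j`. -/
noncomputable def characteristicOn (R : ℝ) (a : ι → ℝ) (ν : ℝ → ℝ≥0∞) (σ : ι → ℝ → ℝ≥0∞)
    (l u : ℝ) : ℝ≥0∞ :=
  (⨍⁻ x in Set.Ioo l u, ν x ∂volume) ^ R * ∏ j, (⨍⁻ x in Set.Ioo l u, σ j x ∂volume) ^ a j

variable {S : ι → ℝ} {ν : ℝ → ℝ≥0∞} {σ g : ι → ℝ → ℝ≥0∞} {K : ℝ≥0∞} {R : ℝ} {a : ι → ℝ} {l u : ℝ}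

theorem le_multilinearMaximal (S : ι → ℝ) (g : ι → ℝ → ℝ≥0∞) {x : ℝ} (hx : x ∈ Set.Ioo l u) :
    ∏ j, (⨍⁻ y in Set.Ioo l u, g j y ∂volume) ^ S j ≤ multilinearMaximal S g x :=
  le_iSup₂_of_le l u (le_iSup_of_le hx le_rfl)

theorem setLAverage_dual_ne_top (hν : IsRegularWeight ν) (hσ : ∀ j, IsRegularWeight (σ j))
    (hR : 0 ≤ R) (ha : ∀ j, 0 < a j) (hlu : l < u) (hK : characteristicOn R a ν σ l u ≠ ∞) (j : ι) :
    ⨍⁻ x in Set.Ioo l u, σ j x ∂volume ≠ ∞ := by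
  have hV : (⨍⁻ x in Set.Ioo l u, ν x ∂volume) ^ R ≠ 0 := by
    simp [ENNReal.rpow_eq_zero_iff, hν.setLAverage_Ioo_ne_zero hlu, hR]
  have hA (i : ι) : (⨍⁻ x in Set.Ioo l u, σ i x ∂volume) ^ a i ≠ 0 := by
    simp [ENNReal.rpow_eq_zero_iff, (hσ i).setLAverage_Ioo_ne_zero hlu, (ha i).le]
  intro htop
  have hAj : (⨍⁻ x in Set.Ioo l u, σ j x ∂volume) ^ a j = ∞ := by
    rw [htop, ENNReal.top_rpow_of_pos (ha j)]
  exact hK (ENNReal.mul_eq_top.2 <| Or.inl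
    ⟨hV, WithTop.prod_eq_top (Finset.mem_univ j) hAj fun i _ => hA i⟩)

theorem setLAverage_joint_ne_top (hσ : ∀ j, IsRegularWeight (σ j)) (hR : 0 < R)
    (ha : ∀ j, 0 ≤ a j) (hlu : l < u) (hK : characteristicOn R a ν σ l u ≠ ∞) :
    ⨍⁻ x in Set.Ioo l u, ν x ∂volume ≠ ∞ := by
  have hA (i : ι) : (⨍⁻ x in Set.Ioo l u, σ i x ∂volume) ^ a i ≠ 0 := by
    simp [ENNReal.rpow_eq_zero_iff, (hσ i).setLAverage_Ioo_ne_zero hlu, ha i]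
  intro htop
  refine hK (ENNReal.mul_eq_top.2 <| Or.inr ⟨?_, Finset.prod_ne_zero_iff.2 fun i _ => hA i⟩)
  rw [htop, ENNReal.top_rpow_of_pos hR]

theorem prod_setLAverage_rpow_le_mul_prod_weightedMaximal (hσ : ∀ j, IsRegularWeight (σ j))
    (hg : ∀ j, Measurable (g j)) (hS : ∀ j, 0 ≤ S j) {x : ℝ} (hx : x ∈ Set.Ioo l u)
    (htop : ∀ j, ⨍⁻ y in Set.Ioo l u, σ j y ∂volume ≠ ∞) :
    ∏ j, (⨍⁻ y in Set.Ioo l u, g j y ∂volume) ^ S j ≤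
      (∏ j, (⨍⁻ y in Set.Ioo l u, σ j y ∂volume) ^ S j) *
        ∏ j, weightedMaximal (σ j) (g j) x ^ S j := by
  rw [← Finset.prod_mul_distrib]
  refine Finset.prod_le_prod' fun j _ => ?_
  rw [← ENNReal.mul_rpow_of_nonneg _ _ (hS j)]
  exact ENNReal.rpow_le_rpow (setLAverage_le_mul_weightedMaximal (hσ j) (hg j) hx (htop j)) (hS j)

/-- The density whose maximal function with respect to the joint weight dominates the multilinear
maximal function. -/
noncomputable def jointDensity (θ : ℝ) (b S : ι → ℝ) (σ g : ι → ℝ → ℝ≥0∞) (x : ℝ) : ℝ≥0∞ :=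
  (∏ j, σ j x ^ (-b j) * weightedMaximal (σ j) (g j) x ^ S j) ^ (1 / θ)

theorem measurable_jointDensity (hσ : ∀ j, Measurable (σ j)) (θ : ℝ) (b S : ι → ℝ)
    (g : ι → ℝ → ℝ≥0∞) : Measurable (jointDensity θ b S σ g) :=
  (Finset.measurable_fun_prod _ fun j _ =>
    ((hσ j).pow_const _).mul ((measurable_weightedMaximal _ _).pow_const _)).pow_const _

theorem setLAverage_mul_le_setLAverage_jointDensity (hσ : ∀ j, Measurable (σ j)) {θ : ℝ}
    (hθ : 0 < θ) (b : ι → ℝ) {T : ℝ≥0∞}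
    (hT : ∀ x ∈ Set.Ioo l u, T ≤ ∏ j, weightedMaximal (σ j) (g j) x ^ S j) :
    (⨍⁻ x in Set.Ioo l u, (∏ j, σ j x ^ (-b j)) ^ (1 / θ) ∂volume) * T ^ (1 / θ) ≤
      ⨍⁻ x in Set.Ioo l u, jointDensity θ b S σ g x ∂volume := by
  have hZ : Measurable fun x => (∏ j, σ j x ^ (-b j)) ^ (1 / θ) :=
    (Finset.measurable_fun_prod _ fun j _ => (hσ j).pow_const _).pow_const _
  rw [setLAverage_eq, setLAverage_eq, ← ENNReal.mul_div_right_comm, ← lintegral_mul_const _ hZ]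
  refine ENNReal.div_le_div_right (setLIntegral_mono' measurableSet_Ioo fun x hx => ?_) _
  rw [← ENNReal.mul_rpow_of_nonneg _ _ (by positivity), jointDensity, Finset.prod_mul_distrib]
  gcongr
  exact hT x hx

theorem prod_setLAverage_rpow_le_of_characteristicOn_le (hν : IsRegularWeight ν)
    (hσ : ∀ j, IsRegularWeight (σ j)) (hR : 0 < R) (ha : ∀ j, 0 < a j) {γ : ℝ} (hγ : 0 < γ)
    (hγS : ∀ j, S j ≤ γ * a j) (hlu : l < u) (hK_top : K ≠ ∞)
    (hK : characteristicOn R a ν σ l u ≤ K) :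
    ∏ j, (⨍⁻ x in Set.Ioo l u, σ j x ∂volume) ^ S j ≤
      K ^ γ * ((⨍⁻ x in Set.Ioo l u, ν x ∂volume)⁻¹ *
        ⨍⁻ x in Set.Ioo l u, (∏ j, σ j x ^ (-(γ * a j - S j))) ^ (1 / (γ * R)) ∂volume)
          ^ (γ * R) := by
  have hchar := ne_top_of_le_ne_top hK_top hK
  have : NeZero (volume (Set.Ioo l u)) := ⟨by simp [hlu]⟩
  exact prod_rpow_le_of_rpow_mul_prod_le (fun j => (hσ j).setLAverage_Ioo_ne_zero hlu)
    (setLAverage_dual_ne_top hν hσ hR.le ha hlu hchar) (hν.setLAverage_Ioo_ne_zero hlu)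
    (setLAverage_joint_ne_top hσ hR (fun j => (ha j).le) hlu hchar) hR.le hγ.le hK
    (one_le_laverage_rpow_mul_prod _ hσ (mul_pos hγ hR) fun j => sub_nonneg.2 (hγS j))

theorem inv_mul_le_weightedMaximal_jointDensity (hν : IsRegularWeight ν)
    (hσ : ∀ j, Measurable (σ j)) {θ : ℝ} (hθ : 0 < θ) (b : ι → ℝ) {T : ℝ≥0∞}
    (hT : ∀ x ∈ Set.Ioo l u, T ≤ ∏ j, weightedMaximal (σ j) (g j) x ^ S j)
    (hν_top : ⨍⁻ x in Set.Ioo l u, ν x ∂volume ≠ ∞) {x : ℝ} (hx : x ∈ Set.Ioo l u) :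
    (⨍⁻ x in Set.Ioo l u, ν x ∂volume)⁻¹ *
        ((⨍⁻ x in Set.Ioo l u, (∏ j, σ j x ^ (-b j)) ^ (1 / θ) ∂volume) * T ^ (1 / θ)) ≤
      weightedMaximal ν (jointDensity θ b S σ g) x := by
  rw [ENNReal.inv_mul_le_iff (hν.setLAverage_Ioo_ne_zero (hx.1.trans hx.2)) hν_top]
  exact (setLAverage_mul_le_setLAverage_jointDensity hσ hθ b hT).trans
    (setLAverage_le_mul_weightedMaximal hν (measurable_jointDensity hσ _ _ _ _) hx hν_top)

theorem prod_setLAverage_rpow_le_weightedMaximal_jointDensity (hν : IsRegularWeight ν)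
    (hσ : ∀ j, IsRegularWeight (σ j)) (hg : ∀ j, Measurable (g j)) (hS : ∀ j, 0 ≤ S j)
    (hR : 0 < R) (ha : ∀ j, 0 < a j) {γ : ℝ} (hγ : 0 < γ) (hγS : ∀ j, S j ≤ γ * a j)
    (hK_top : K ≠ ∞) (hK : characteristicOn R a ν σ l u ≤ K) {x : ℝ} (hx : x ∈ Set.Ioo l u) :
    ∏ j, (⨍⁻ y in Set.Ioo l u, g j y ∂volume) ^ S j ≤
      K ^ γ * weightedMaximal ν (jointDensity (γ * R) (fun j => γ * a j - S j) S σ g) x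
        ^ (γ * R) := by
  have hlu : l < u := hx.1.trans hx.2
  have hθ : 0 < γ * R := mul_pos hγ hR
  have hchar := ne_top_of_le_ne_top hK_top hK
  have hV_top := setLAverage_joint_ne_top hσ hR (fun j => (ha j).le) hlu hchar
  have hA_top := setLAverage_dual_ne_top hν hσ hR.le ha hlu hchar
  set F := jointDensity (γ * R) (fun j => γ * a j - S j) S σ g
  set V := ⨍⁻ y in Set.Ioo l u, ν y ∂volume
  set Z := ⨍⁻ y in Set.Ioo l u, (∏ j, σ j y ^ (-(γ * a j - S j))) ^ (1 / (γ * R)) ∂volume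
  set D := ∏ j, (⨍⁻ y in Set.Ioo l u, σ j y ∂volume) ^ S j
  set G := ∏ j, (⨍⁻ y in Set.Ioo l u, g j y ∂volume) ^ S j
  have hA₀ := fun j => (hσ j).setLAverage_Ioo_ne_zero hlu
  have hD₀ : D ≠ 0 := Finset.prod_ne_zero_iff.2 fun j _ =>
    (ENNReal.rpow_pos (pos_iff_ne_zero.2 (hA₀ j)) (hA_top j)).ne'
  have hD_top : D ≠ ∞ := ENNReal.prod_ne_top fun j _ =>
    ENNReal.rpow_ne_top_of_nonneg (hS j) (hA_top j)
  have hGD (y : ℝ) (hy : y ∈ Set.Ioo l u) :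
      G / D ≤ ∏ j, weightedMaximal (σ j) (g j) y ^ S j :=
    ENNReal.div_le_of_le_mul'
      (prod_setLAverage_rpow_le_mul_prod_weightedMaximal hσ hg hS hy hA_top)
  have hmax : V⁻¹ * (Z * (G / D) ^ (1 / (γ * R))) ≤ weightedMaximal ν F x :=
    inv_mul_le_weightedMaximal_jointDensity hν (fun j => (hσ j).measurable) hθ _ hGD hV_top hx
  calc G = D * (G / D) := (ENNReal.mul_div_cancel hD₀ hD_top).symm
    _ ≤ K ^ γ * (V⁻¹ * Z) ^ (γ * R) * (G / D) := by
        gcongr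
        exact prod_setLAverage_rpow_le_of_characteristicOn_le hν hσ hR ha hγ hγS hlu hK_top hK
    _ = K ^ γ * (V⁻¹ * (Z * (G / D) ^ (1 / (γ * R)))) ^ (γ * R) := by
        rw [← mul_assoc V⁻¹, ENNReal.mul_rpow_of_nonneg _ ((G / D) ^ _) hθ.le, ← ENNReal.rpow_mul,
          one_div_mul_cancel hθ.ne', ENNReal.rpow_one, mul_assoc]
    _ ≤ K ^ γ * weightedMaximal ν F x ^ (γ * R) := by gcongr

end Multilinear

section Sufficiency

variable {ι : Type*} [Fintype ι] {S r : ι → ℝ} {q : ι → ℝ≥0∞} {q₀ : ℝ≥0∞} {ν : ℝ → ℝ≥0∞}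
  {σ g : ι → ℝ → ℝ≥0∞} {K : ℝ≥0∞} {R : ℝ} {a : ι → ℝ}

theorem multilinearMaximal_le_mul_weightedMaximal_jointDensity (hν : IsRegularWeight ν)
    (hσ : ∀ j, IsRegularWeight (σ j)) (hg : ∀ j, Measurable (g j)) (hS : ∀ j, 0 ≤ S j)
    (hR : 0 < R) (ha : ∀ j, 0 < a j) {γ : ℝ} (hγ : 0 < γ) (hγS : ∀ j, S j ≤ γ * a j)
    (hK_top : K ≠ ∞) (hK : ∀ l u, l < u → characteristicOn R a ν σ l u ≤ K) (x : ℝ) :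
    multilinearMaximal S g x ≤
      K ^ γ * weightedMaximal ν (jointDensity (γ * R) (fun j => γ * a j - S j) S σ g) x
        ^ (γ * R) :=
  iSup₂_le fun l u => iSup_le fun hx =>
    prod_setLAverage_rpow_le_weightedMaximal_jointDensity hν hσ hg hS hR ha hγ hγS hK_top
      (hK l u (hx.1.trans hx.2)) hx

theorem multilinearMaximal_le_mul_prod_weightedMaximal (hν : IsRegularWeight ν)
    (hσ : ∀ j, IsRegularWeight (σ j)) (hg : ∀ j, Measurable (g j)) (hS : ∀ j, 0 < S j)
    (hK_top : K ≠ ∞) (hK : ∀ l u, l < u → characteristicOn 0 S ν σ l u ≤ K) (x : ℝ) :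
    multilinearMaximal S g x ≤ K * ∏ j, weightedMaximal (σ j) (g j) x ^ S j := by
  refine iSup₂_le fun l u => iSup_le fun hx => ?_
  have hlu : l < u := hx.1.trans hx.2
  have hchar := hK l u hlu
  refine (prod_setLAverage_rpow_le_mul_prod_weightedMaximal hσ hg (fun j => (hS j).le) hx
    (setLAverage_dual_ne_top hν hσ le_rfl hS hlu (ne_top_of_le_ne_top hK_top hchar))).trans ?_
  gcongr
  simpa only [characteristicOn, ENNReal.rpow_zero, one_mul] using hchar

theorem jointDensity_rpow_mul_rpow_sub (hσ : ∀ j, IsRegularWeight (σ j)) {γ : ℝ}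
    (hθ : 0 < γ * R) {x : ℝ}
    (hνσ : ν x ^ R = ∏ j, σ j x ^ (r j - S j)) :
    jointDensity (γ * R) (fun j => γ * (S j - r j) - S j) S σ g x ^ (γ * R) *
        ν x ^ (R - γ * R) =
      ∏ j, weightedMaximal (σ j) (g j) x ^ S j * σ j x ^ r j := by
  have hνγ : ν x ^ (R - γ * R) = ∏ j, σ j x ^ ((r j - S j) * (1 - γ)) := by
    rw [← one_sub_mul, mul_comm, ENNReal.rpow_mul, hνσ, ← ENNReal.prod_rpow_of_ne_top fun j _ =>
      ENNReal.rpow_ne_top_of_ne_zero ((hσ j).ne_zero x) ((hσ j).ne_top x)]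
    simp only [ENNReal.rpow_mul]
  rw [hνγ, jointDensity, ← ENNReal.rpow_mul, one_div_mul_cancel hθ.ne', ENNReal.rpow_one,
    ← Finset.prod_mul_distrib]
  refine Finset.prod_congr rfl fun j _ => ?_
  rw [mul_right_comm, ← ENNReal.rpow_add _ _ ((hσ j).ne_zero x) ((hσ j).ne_top x), mul_comm]
  congr 2
  ring

theorem exists_eLpNorm_prod_weightedMaximal_le (hq : q₀⁻¹ = ∑ j, (q j)⁻¹)
    (hq_ne : ∀ j, q j ≠ 0) (hS : ∀ j, ((q j)⁻¹).toReal < S j) :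
    ∃ C : ℝ≥0, ∀ σ g : ι → ℝ → ℝ≥0∞, (∀ j, IsRegularWeight (σ j)) → (∀ j, Measurable (g j)) →
      eLpNorm (fun x => ∏ j, weightedMaximal (σ j) (g j) x ^ S j * σ j x ^ ((q j)⁻¹).toReal)
          q₀ volume ≤
        C * ∏ j, eLpNorm (fun x => g j x ^ S j * σ j x ^ (((q j)⁻¹).toReal - S j))
          (q j) volume := by
  choose C hC using fun j => exists_eLpNorm_weightedMaximal_rpow_mul_le (hq_ne j) (hS j)
  refine ⟨∏ j, C j, fun σ g hσ hg => ?_⟩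
  have hholder := eLpNorm_finset_prod_le Finset.univ (μ := volume)
    (F := fun j x => weightedMaximal (σ j) (g j) x ^ S j * σ j x ^ ((q j)⁻¹).toReal)
    (fun j => (((measurable_weightedMaximal _ _).pow_const _).mul
      ((hσ j).measurable.pow_const _)).aemeasurable) (fun j _ => hq_ne j)
  rw [← hq, inv_inv] at hholder
  rw [ENNReal.ofNNReal_finsetProd, ← Finset.prod_mul_distrib]
  exact hholder.trans (Finset.prod_le_prod' fun j _ => hC j (σ j) (g j) (hσ j) (hg j))

theorem exists_eLpNorm_multilinearMaximal_le_prod_weightedMaximal_of_pos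
    (hq : (q₀⁻¹).toReal = R) (hq_ne : q₀ ≠ 0) (hR : 0 < R) (hr : ∀ j, 0 ≤ r j)
    (hrS : ∀ j, r j < S j) (hν : IsRegularWeight ν) (hσ : ∀ j, IsRegularWeight (σ j))
    (hνσ : ∀ x, ν x ^ R = ∏ j, σ j x ^ (r j - S j)) (hK_top : K ≠ ∞)
    (hK : ∀ l u, l < u → characteristicOn R (fun j => S j - r j) ν σ l u ≤ K) :
    ∃ C : ℝ≥0, ∀ g : ι → ℝ → ℝ≥0∞, (∀ j, Measurable (g j)) →
      eLpNorm (fun x => multilinearMaximal S g x * ν x ^ R) q₀ volume ≤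
        C * eLpNorm (fun x => ∏ j, weightedMaximal (σ j) (g j) x ^ S j * σ j x ^ r j)
          q₀ volume := by
  have hS (j : ι) : 0 < S j := (hr j).trans_lt (hrS j)
  obtain ⟨γ, hγ, hγS⟩ := exists_one_lt_and_le_mul_sub hr hrS
  have hγ₀ : 0 < γ := zero_lt_one.trans hγ
  obtain ⟨C, hC⟩ := exists_eLpNorm_weightedMaximal_rpow_mul_le (S := γ * R) hq_ne
    (hq.trans_lt (lt_mul_of_one_lt_left hR hγ))
  lift K to ℝ≥0 using hK_top
  refine ⟨K ^ γ * C, fun g hg => ?_⟩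
  set F := jointDensity (γ * R) (fun j => γ * (S j - r j) - S j) S σ g
  have hF : Measurable F := measurable_jointDensity (fun j => (hσ j).measurable) _ _ _ _
  calc eLpNorm (fun x => multilinearMaximal S g x * ν x ^ R) q₀ volume
      ≤ (K ^ γ : ℝ≥0) • eLpNorm (fun x => weightedMaximal ν F x ^ (γ * R) * ν x ^ R)
          q₀ volume := by
        refine eLpNorm_le_nnreal_smul_eLpNorm_of_ae_le_mul' (.of_forall fun x => ?_) _
        simp only [enorm_eq_self]
        rw [← mul_assoc, ENNReal.coe_rpow_of_nonneg _ hγ₀.le]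
        gcongr
        exact multilinearMaximal_le_mul_weightedMaximal_jointDensity hν hσ hg
          (fun j => (hS j).le) hR (fun j => sub_pos.2 (hrS j)) hγ₀ hγS ENNReal.coe_ne_top hK x
    _ ≤ (K ^ γ : ℝ≥0) * (C * eLpNorm (fun x => F x ^ (γ * R) * ν x ^ (R - γ * R))
          q₀ volume) := by
        rw [ENNReal.smul_def, smul_eq_mul]
        gcongr
        simpa only [hq] using hC ν F hν hF
    _ = (K ^ γ * C : ℝ≥0) * eLpNorm (fun x => ∏ j, weightedMaximal (σ j) (g j) x ^ S j *
          σ j x ^ r j) q₀ volume := by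
        simp only [F, jointDensity_rpow_mul_rpow_sub hσ (mul_pos hγ₀ hR) (hνσ _)]
        rw [ENNReal.coe_mul, mul_assoc]

theorem exists_eLpNorm_multilinearMaximal_le_prod_weightedMaximal
    (hq : (q₀⁻¹).toReal = R) (hq_ne : q₀ ≠ 0) (hr : ∀ j, 0 ≤ r j) (hrS : ∀ j, r j < S j)
    (hrR : ∀ j, r j ≤ R) (hν : IsRegularWeight ν)
    (hσ : ∀ j, IsRegularWeight (σ j)) (hνσ : ∀ x, ν x ^ R = ∏ j, σ j x ^ (r j - S j))
    (hK_top : K ≠ ∞)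
    (hK : ∀ l u, l < u → characteristicOn R (fun j => S j - r j) ν σ l u ≤ K) :
    ∃ C : ℝ≥0, ∀ g : ι → ℝ → ℝ≥0∞, (∀ j, Measurable (g j)) →
      eLpNorm (fun x => multilinearMaximal S g x * ν x ^ R) q₀ volume ≤
        C * eLpNorm (fun x => ∏ j, weightedMaximal (σ j) (g j) x ^ S j * σ j x ^ r j)
          q₀ volume := by
  rcases (hq ▸ ENNReal.toReal_nonneg : 0 ≤ R).eq_or_lt with rfl | hR
  · have hS (j : ι) : 0 < S j := (hr j).trans_lt (hrS j)
    have hr₀ (j : ι) : r j = 0 := (hrR j).antisymm (hr j)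
    lift K to ℝ≥0 using hK_top
    refine ⟨K, fun g hg => eLpNorm_le_nnreal_smul_eLpNorm_of_ae_le_mul' (.of_forall fun x => ?_) _⟩
    simp only [hr₀, sub_zero] at hK
    simpa only [hr₀, ENNReal.rpow_zero, mul_one, enorm_eq_self] using
      multilinearMaximal_le_mul_prod_weightedMaximal hν hσ hg hS ENNReal.coe_ne_top hK x
  · exact exists_eLpNorm_multilinearMaximal_le_prod_weightedMaximal_of_pos hq hq_ne hR hr hrS hν hσ
      hνσ hK_top hK

theorem exists_eLpNorm_multilinearMaximal_le (hq : q₀⁻¹ = ∑ j, (q j)⁻¹)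
    (hq_ne : ∀ j, q j ≠ 0) (hS : ∀ j, ((q j)⁻¹).toReal < S j) (hν : IsRegularWeight ν)
    (hσ : ∀ j, IsRegularWeight (σ j))
    (hνσ : ∀ x, ν x ^ (q₀⁻¹).toReal = ∏ j, σ j x ^ (((q j)⁻¹).toReal - S j)) (hK_top : K ≠ ∞)
    (hK : ∀ l u, l < u →
      characteristicOn (q₀⁻¹).toReal (fun j => S j - ((q j)⁻¹).toReal) ν σ l u ≤ K) :
    ∃ C : ℝ≥0, ∀ g : ι → ℝ → ℝ≥0∞, (∀ j, Measurable (g j)) →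
      eLpNorm (fun x => multilinearMaximal S g x * ν x ^ (q₀⁻¹).toReal) q₀ volume ≤
        C * ∏ j, eLpNorm (fun x => g j x ^ S j * σ j x ^ (((q j)⁻¹).toReal - S j))
          (q j) volume := by
  have hq₀ : q₀ ≠ 0 := ne_zero_of_inv_eq_sum_inv hq hq_ne
  have hinv_le (j : ι) : ((q j)⁻¹).toReal ≤ (q₀⁻¹).toReal :=
    ENNReal.toReal_mono (ENNReal.inv_ne_top.2 hq₀)
      (ENNReal.inv_le_inv.2 (le_of_inv_eq_sum_inv hq j))
  obtain ⟨C₁, hC₁⟩ := exists_eLpNorm_multilinearMaximal_le_prod_weightedMaximal rfl hq₀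
    (fun _ => ENNReal.toReal_nonneg) hS hinv_le hν hσ hνσ hK_top hK
  obtain ⟨C₂, hC₂⟩ := exists_eLpNorm_prod_weightedMaximal_le hq hq_ne hS
  refine ⟨C₁ * C₂, fun g hg => (hC₁ g hg).trans ?_⟩
  rw [ENNReal.coe_mul, mul_assoc]
  gcongr
  exact hC₂ σ g hσ hg

end Sufficiency

section Necessity

variable {ι : Type*} [Fintype ι] {S r : ι → ℝ} {q : ι → ℝ≥0∞} {q₀ : ℝ≥0∞} {ν : ℝ → ℝ≥0∞}
  {σ m : ι → ℝ → ℝ≥0∞} {C : ℝ≥0∞} {l u : ℝ}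

theorem tendsto_laverage_min_natCast {α : Type*} [MeasurableSpace α] (μ : Measure α)
    {f : α → ℝ≥0∞} (hf : Measurable f) :
    Filter.Tendsto (fun N : ℕ => ⨍⁻ x, min (f x) N ∂μ) Filter.atTop (nhds (⨍⁻ x, f x ∂μ)) := by
  refine lintegral_tendsto_of_tendsto_of_monotone
    (fun N => (hf.min measurable_const).aemeasurable)
    (.of_forall fun x N M hNM => min_le_min_left _ (Nat.cast_le.2 hNM)) (.of_forall fun x => ?_)
  simpa only [min_top_right] using
    (tendsto_const_nhds (x := f x)).min ENNReal.tendsto_nat_nhds_top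

theorem eLpNorm_indicator_rpow_mul_rpow_sub_le {q : ℝ≥0∞} (hq : q ≠ 0) {S : ℝ}
    (hS : (q⁻¹).toReal < S) {W V : ℝ → ℝ≥0∞} (hV : IsRegularWeight V) (hVW : ∀ x, V x ≤ W x)
    {s : Set ℝ} (hs : MeasurableSet s) :
    eLpNorm (fun x => s.indicator V x ^ S * W x ^ ((q⁻¹).toReal - S)) q volume ≤
      (∫⁻ x in s, V x) ^ (q⁻¹).toReal := by
  have hpointwise (x : ℝ) : s.indicator V x ^ S * W x ^ ((q⁻¹).toReal - S) ≤
      ‖s.indicator (fun _ => (1 : ℝ≥0∞)) x‖ₑ * V x ^ (q⁻¹).toReal := by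
    by_cases hx : x ∈ s
    · simp only [Set.indicator_of_mem hx, enorm_eq_self, one_mul]
      calc V x ^ S * W x ^ ((q⁻¹).toReal - S) ≤ V x ^ S * V x ^ ((q⁻¹).toReal - S) := by
            gcongr V x ^ S * ?_
            rw [← neg_sub, ENNReal.rpow_neg, ENNReal.rpow_neg]
            exact ENNReal.inv_le_inv.2 (ENNReal.rpow_le_rpow (hVW x) (sub_nonneg.2 hS.le))
        _ = V x ^ (q⁻¹).toReal := by
            rw [← ENNReal.rpow_add _ _ (hV.ne_zero x) (hV.ne_top x), add_sub_cancel]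
    · simp [Set.indicator_of_notMem hx, ENNReal.zero_rpow_of_pos
        (ENNReal.toReal_nonneg.trans_lt hS)]
  calc eLpNorm (fun x => s.indicator V x ^ S * W x ^ ((q⁻¹).toReal - S)) q volume
      ≤ eLpNorm (s.indicator fun _ => (1 : ℝ≥0∞)) q (volume.withDensity V) := by
        rw [hV.eLpNorm_withDensity _ hq]
        exact eLpNorm_mono_enorm hpointwise
    _ ≤ (∫⁻ x in s, V x) ^ (q⁻¹).toReal := by
        refine (eLpNorm_indicator_const_le _ _).trans_eq ?_
        rw [enorm_eq_self, one_mul, withDensity_apply _ hs, one_div, ENNReal.toReal_inv]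

theorem prod_setLAverage_rpow_mul_le_eLpNorm_multilinearMaximal (hq : q₀ ≠ 0)
    (hν : IsRegularWeight ν) (S : ι → ℝ) (g : ι → ℝ → ℝ≥0∞) (hlu : l < u) :
    (∏ j, (⨍⁻ x in Set.Ioo l u, g j x ∂volume) ^ S j) *
        (∫⁻ x in Set.Ioo l u, ν x) ^ (q₀⁻¹).toReal ≤
      eLpNorm (fun x => multilinearMaximal S g x * ν x ^ (q₀⁻¹).toReal) q₀ volume := by
  have hνQ : volume.withDensity ν (Set.Ioo l u) = ∫⁻ x in Set.Ioo l u, ν x :=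
    withDensity_apply _ measurableSet_Ioo
  have hνQ₀ : volume.withDensity ν (Set.Ioo l u) ≠ 0 :=
    hνQ ▸ hν.setLIntegral_ne_zero (by simp [hlu])
  set T := ∏ j, (⨍⁻ x in Set.Ioo l u, g j x ∂volume) ^ S j
  calc T * (∫⁻ x in Set.Ioo l u, ν x) ^ (q₀⁻¹).toReal
      = eLpNorm ((Set.Ioo l u).indicator fun _ => T) q₀ (volume.withDensity ν) := by
        rw [eLpNorm_indicator_const' measurableSet_Ioo hνQ₀ hq, hνQ, enorm_eq_self, one_div,
          ENNReal.toReal_inv]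
    _ ≤ eLpNorm (multilinearMaximal S g) q₀ (volume.withDensity ν) := by
        refine eLpNorm_mono_enorm fun x => ?_
        simp only [enorm_eq_self]
        exact Set.indicator_apply_le' (fun hx => le_multilinearMaximal S g hx) fun _ => bot_le
    _ = eLpNorm (fun x => multilinearMaximal S g x * ν x ^ (q₀⁻¹).toReal) q₀ volume := by
        simp only [hν.eLpNorm_withDensity _ hq, enorm_eq_self]

theorem rpow_mul_prod_rpow_sub_le {A : ι → ℝ≥0∞} {L V : ℝ≥0∞} (hA₀ : ∀ j, A j ≠ 0)
    (hA : ∀ j, A j ≠ ∞) (hL₀ : L ≠ 0) (hL : L ≠ ∞) (hr : ∀ j, 0 ≤ r j)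
    (h : (∏ j, A j ^ S j) * (L * V) ^ (∑ j, r j) ≤ C * ∏ j, (L * A j) ^ r j) :
    V ^ (∑ j, r j) * ∏ j, A j ^ (S j - r j) ≤ C := by
  have hLA₀ (j : ι) : (L * A j) ^ r j ≠ 0 := by
    simp [ENNReal.rpow_eq_zero_iff, hL₀, hA₀, (hr j)]
  have hLA (j : ι) : (L * A j) ^ r j ≠ ∞ :=
    ENNReal.rpow_ne_top_of_nonneg (hr j) (ENNReal.mul_ne_top hL (hA j))
  have hfactor : V ^ (∑ j, r j) * (∏ j, A j ^ (S j - r j)) * ∏ j, (L * A j) ^ r j =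
      (∏ j, A j ^ S j) * (L * V) ^ (∑ j, r j) := by
    have hterm (j : ι) : A j ^ (S j - r j) * (L * A j) ^ r j = L ^ r j * A j ^ S j := by
      rw [ENNReal.mul_rpow_of_nonneg _ _ (hr j), mul_left_comm,
        ← ENNReal.rpow_add _ _ (hA₀ j) (hA j), sub_add_cancel]
    rw [mul_assoc, ← Finset.prod_mul_distrib, ENNReal.mul_rpow_of_nonneg _ _
      (Finset.sum_nonneg fun j _ => hr j), ennreal_rpow_sum hL₀ hL]
    simp only [hterm, Finset.prod_mul_distrib]
    ring
  rw [← hfactor] at h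
  exact (ENNReal.mul_le_mul_iff_left (Finset.prod_ne_zero_iff.2 fun j _ => hLA₀ j)
    (ENNReal.prod_ne_top fun j _ => hLA j)).1 h

theorem characteristicOn_le_of_eLpNorm_multilinearMaximal_indicator_le (hq : q₀⁻¹ = ∑ j, (q j)⁻¹)
    (hq_ne : ∀ j, q j ≠ 0) (hS : ∀ j, ((q j)⁻¹).toReal < S j) (hν : IsRegularWeight ν)
    (hm : ∀ j, IsRegularWeight (m j)) (hmσ : ∀ j x, m j x ≤ σ j x) (hlu : l < u)
    (hm_top : ∀ j, ⨍⁻ x in Set.Ioo l u, m j x ∂volume ≠ ∞)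
    (hC : eLpNorm (fun x => multilinearMaximal S (fun j => (Set.Ioo l u).indicator (m j)) x *
        ν x ^ (q₀⁻¹).toReal) q₀ volume ≤
      C * ∏ j, eLpNorm (fun x => (Set.Ioo l u).indicator (m j) x ^ S j *
        σ j x ^ (((q j)⁻¹).toReal - S j)) (q j) volume) :
    characteristicOn (q₀⁻¹).toReal (fun j => S j - ((q j)⁻¹).toReal) ν m l u ≤ C := by
  have hR : (q₀⁻¹).toReal = ∑ j, ((q j)⁻¹).toReal := by
    rw [hq, ENNReal.toReal_sum fun j _ => ENNReal.inv_ne_top.2 (hq_ne j)]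
  have hlower := prod_setLAverage_rpow_mul_le_eLpNorm_multilinearMaximal
    (ne_zero_of_inv_eq_sum_inv hq hq_ne) hν S (fun j => (Set.Ioo l u).indicator (m j)) hlu
  have hupper (j : ι) := eLpNorm_indicator_rpow_mul_rpow_sub_le (hq_ne j) (hS j) (hm j) (hmσ j)
    (measurableSet_Ioo (a := l) (b := u))
  have hind (j : ι) : ⨍⁻ x in Set.Ioo l u, (Set.Ioo l u).indicator (m j) x ∂volume =
      ⨍⁻ x in Set.Ioo l u, m j x ∂volume := by
    rw [setLAverage_eq, setLAverage_eq, setLIntegral_indicator measurableSet_Ioo, Set.inter_self]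
  have h := (hlower.trans hC).trans (mul_le_mul_right (Finset.prod_le_prod' fun j _ => hupper j) C)
  have hvol (f : ℝ → ℝ≥0∞) := measure_mul_setLAverage (μ := volume) (s := Set.Ioo l u) f (by simp)
  simp only [hind, ← hvol, hR] at h
  rw [characteristicOn, hR]
  exact rpow_mul_prod_rpow_sub_le (fun j => (hm j).setLAverage_Ioo_ne_zero hlu) hm_top
    (by simp [hlu]) (by simp) (fun _ => ENNReal.toReal_nonneg) h

theorem tendsto_characteristicOn_min_natCast {R : ℝ} {a : ι → ℝ} (ν : ℝ → ℝ≥0∞)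
    (hσ : ∀ j, IsRegularWeight (σ j)) (ha : ∀ j, 0 ≤ a j) (hlu : l < u) :
    Filter.Tendsto (fun N : ℕ => characteristicOn R a ν (fun j x => min (σ j x) N) l u)
      Filter.atTop (nhds (characteristicOn R a ν σ l u)) := by
  have hA (j : ι) : (⨍⁻ x in Set.Ioo l u, σ j x ∂volume) ^ a j ≠ 0 := by
    simp [ENNReal.rpow_eq_zero_iff, (hσ j).setLAverage_Ioo_ne_zero hlu, ha j]
  refine ENNReal.Tendsto.const_mul (ennreal_tendsto_finset_prod_of_ne_zero _ (fun j => ?_) hA)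
    (Or.inl (Finset.prod_ne_zero_iff.2 fun j _ => hA j))
  exact (ENNReal.continuous_rpow_const.tendsto _).comp
    (tendsto_laverage_min_natCast _ (hσ j).measurable)

theorem characteristicOn_le_of_eLpNorm_multilinearMaximal_le (hq : q₀⁻¹ = ∑ j, (q j)⁻¹)
    (hq_ne : ∀ j, q j ≠ 0) (hS : ∀ j, ((q j)⁻¹).toReal < S j) (hν : IsRegularWeight ν)
    (hσ : ∀ j, IsRegularWeight (σ j))
    (hC : ∀ g : ι → ℝ → ℝ≥0∞, (∀ j, Measurable (g j)) → (∀ j x, g j x ≠ ∞) →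
      eLpNorm (fun x => multilinearMaximal S g x * ν x ^ (q₀⁻¹).toReal) q₀ volume ≤
        C * ∏ j, eLpNorm (fun x => g j x ^ S j * σ j x ^ (((q j)⁻¹).toReal - S j))
          (q j) volume) (hlu : l < u) :
    characteristicOn (q₀⁻¹).toReal (fun j => S j - ((q j)⁻¹).toReal) ν σ l u ≤ C := by
  refine le_of_tendsto (tendsto_characteristicOn_min_natCast ν hσ
    (fun j => sub_nonneg.2 (hS j).le) hlu) ((Filter.eventually_ne_atTop 0).mono fun N hN => ?_)
  have hm (j : ι) : IsRegularWeight fun x => min (σ j x) N :=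
    (hσ j).min_const (Nat.cast_ne_zero.2 hN) (ENNReal.natCast_ne_top N)
  refine characteristicOn_le_of_eLpNorm_multilinearMaximal_indicator_le hq hq_ne hS hν hm
    (fun j x => min_le_left _ _) hlu (fun j => ?_) (hC _ (fun j => ?_) fun j x => ?_)
  · exact ne_top_of_le_ne_top (ENNReal.natCast_ne_top N) ((laverage_mono_ae
      (.of_forall fun x => min_le_right _ _)).trans
        (setLAverage_const (by simp [hlu]) (by simp) _).le)
  · exact (hm j).measurable.indicator measurableSet_Ioo
  · exact ne_top_of_le_ne_top ((hm j).ne_top x) (Set.indicator_le_self _ _ x)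

end Necessity

section Translation

theorem toReal_div_mul_toReal_inv {p q : ℝ≥0∞} (hp : p ≠ 0) (hpq : p ≤ q) :
    (p / q).toReal * (p⁻¹).toReal = (q⁻¹).toReal := by
  rw [← ENNReal.toReal_mul, div_eq_mul_inv, mul_right_comm]
  rcases eq_or_ne p ∞ with rfl | hp_top
  · simp [top_le_iff.1 hpq]
  · rw [ENNReal.mul_inv_cancel hp hp_top, one_mul]

variable {s : ℝ≥0} {q : ℝ≥0∞}

theorem toReal_inv_lt_one_div (hs : 0 < s) (hsq : (s : ℝ≥0∞) < q) :
    (q⁻¹).toReal < 1 / (s : ℝ) := by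
  have hs_inv : (s : ℝ≥0∞)⁻¹ ≠ ∞ := by simpa using hs.ne'
  simpa only [ENNReal.toReal_inv, ENNReal.coe_toReal, one_div] using
    ENNReal.toReal_strict_mono hs_inv (ENNReal.inv_lt_inv.2 hsq)

theorem toReal_div_sub_mul (hs : 0 < s) (hsq : (s : ℝ≥0∞) < q) :
    ((s : ℝ≥0∞) / (q - s)).toReal * (1 / (s : ℝ) - (q⁻¹).toReal) = (q⁻¹).toReal := by
  rcases eq_or_ne q ∞ with rfl | hq
  · simp
  lift q to ℝ≥0 using hq
  have hs' : (0 : ℝ) < s := hs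
  have hsq' : (s : ℝ) < q := by exact_mod_cast hsq
  have hq : (0 : ℝ) < q := hs'.trans hsq'
  have hsub : (q : ℝ) - s ≠ 0 := (sub_pos.2 hsq').ne'
  rw [ENNReal.toReal_div, ENNReal.toReal_sub_of_le hsq.le ENNReal.coe_ne_top, ENNReal.toReal_inv]
  simp only [ENNReal.coe_toReal]
  field_simp

theorem exists_isRegularWeight_ae_eq {α : Type*} [MeasurableSpace α] {μ : Measure α} {w : α → ℝ}
    (hw : AEMeasurable w μ) (hpos : ∀ᵐ x ∂μ, 0 < w x) :
    ∃ W : α → ℝ≥0∞, IsRegularWeight W ∧ (fun x => ENNReal.ofReal (w x)) =ᵐ[μ] W := by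
  classical
  have hS : MeasurableSet {x | 0 < hw.mk w x} :=
    measurableSet_lt measurable_const hw.measurable_mk
  refine ⟨fun x => if 0 < hw.mk w x then ENNReal.ofReal (hw.mk w x) else 1,
    ⟨Measurable.ite hS hw.measurable_mk.ennreal_ofReal measurable_const, fun x => ?_, fun x => ?_⟩,
    ?_⟩
  · split_ifs with hx
    · exact (ENNReal.ofReal_pos.2 hx).ne'
    · exact one_ne_zero
  · split_ifs
    · exact ENNReal.ofReal_ne_top
    · exact ENNReal.one_ne_top
  · filter_upwards [hw.ae_eq_mk, hpos] with x hx hx_pos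
    rw [if_pos (hx ▸ hx_pos), hx]

theorem exists_measurable_enorm_rpow_eq {α : Type*} [MeasurableSpace α] {s : ℝ} (hs : 0 < s)
    {g : α → ℝ≥0∞} (hg : Measurable g) (hg_top : ∀ x, g x ≠ ∞) :
    ∃ f : α → ℂ, Measurable f ∧ ∀ x, ‖f x‖ₑ ^ s = g x := by
  refine ⟨fun x => ((g x ^ (1 / s)).toReal : ℂ),
    Complex.measurable_ofReal.comp (hg.pow_const _).ennreal_toReal, fun x => ?_⟩
  have hroot : g x ^ (1 / s) ≠ ∞ := ENNReal.rpow_ne_top_of_nonneg (by positivity) (hg_top x)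
  rw [← ofReal_norm, Complex.norm_real, Real.norm_of_nonneg ENNReal.toReal_nonneg,
    ENNReal.ofReal_toReal hroot, ← ENNReal.rpow_mul, one_div_mul_cancel hs.ne', ENNReal.rpow_one]

/-- The dual weight `w ^ (-s / (q - s))` of a weight of exponent `q`, as an extended nonnegative
density; it is constantly `1` for `q = ∞`. -/
noncomputable def dualWeight (s : ℝ≥0) (q : ℝ≥0∞) (W : ℝ → ℝ≥0∞) (x : ℝ) : ℝ≥0∞ :=
  W x ^ (-((s : ℝ≥0∞) / (q - (s : ℝ≥0∞))).toReal)

variable {W : ℝ → ℝ≥0∞} {w : ℝ → ℝ}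

theorem IsRegularWeight.dualWeight (hW : IsRegularWeight W) (s : ℝ≥0) (q : ℝ≥0∞) :
    IsRegularWeight (dualWeight s q W) :=
  hW.rpow _

theorem dualWeight_rpow_sub (hs : 0 < s) (hsq : (s : ℝ≥0∞) < q) (W : ℝ → ℝ≥0∞) (x : ℝ) :
    dualWeight s q W x ^ ((q⁻¹).toReal - 1 / (s : ℝ)) = W x ^ (q⁻¹).toReal := by
  rw [dualWeight, ← ENNReal.rpow_mul, neg_mul_comm, neg_sub, toReal_div_sub_mul hs hsq]

theorem eLpNorm_weightMeasure_eq (hs : 0 < s) (hsq : (s : ℝ≥0∞) < q) (hW : IsRegularWeight W)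
    (hwW : (fun x => ENNReal.ofReal (w x)) =ᵐ[volume] W) (f : ℝ → ℂ) :
    eLpNorm f q (weightMeasure w) = eLpNorm (fun x => (‖f x‖ₑ ^ (s : ℝ)) ^ (1 / (s : ℝ)) *
      dualWeight s q W x ^ ((q⁻¹).toReal - 1 / (s : ℝ))) q volume := by
  have hs' : (s : ℝ) ≠ 0 := by exact_mod_cast hs.ne'
  simp only [dualWeight_rpow_sub hs hsq, ← ENNReal.rpow_mul, mul_one_div_cancel hs',
    ENNReal.rpow_one]
  rw [weightMeasure, withDensity_congr_ae hwW, hW.eLpNorm_withDensity _ (bot_le.trans_lt hsq).ne']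

end Translation

section VectorWeight

/-- The joint weight `∏ j, w j ^ (q₀ / q j)` as an extended nonnegative density. -/
noncomputable def jointWeight {ι : Type*} [Fintype ι] (q : ι → ℝ≥0∞) (q₀ : ℝ≥0∞)
    (W : ι → ℝ → ℝ≥0∞) (x : ℝ) : ℝ≥0∞ :=
  ∏ j, W j x ^ (q₀ / q j).toReal

theorem isRegularWeight_jointWeight {ι : Type*} [Fintype ι] {W : ι → ℝ → ℝ≥0∞}
    (hW : ∀ j, IsRegularWeight (W j)) (q : ι → ℝ≥0∞) (q₀ : ℝ≥0∞) :
    IsRegularWeight (jointWeight q q₀ W) :=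
  .finset_prod _ fun j => (hW j).rpow _

variable {n : ℕ} {s : Fin n → ℝ≥0} {q : Fin n → ℝ≥0∞} {q₀ : ℝ≥0∞} {w : Fin n → ℝ → ℝ}
  {W : Fin n → ℝ → ℝ≥0∞}

theorem jointWeight_rpow (hs : ∀ j, 0 < s j) (hsq : ∀ j, (s j : ℝ≥0∞) < q j)
    (hq : q₀⁻¹ = ∑ j, (q j)⁻¹) (W : Fin n → ℝ → ℝ≥0∞) (x : ℝ) :
    jointWeight q q₀ W x ^ (q₀⁻¹).toReal =
      ∏ j, dualWeight (s j) (q j) (W j) x ^ (((q j)⁻¹).toReal - 1 / (s j : ℝ)) := by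
  have hq₀ : q₀ ≠ 0 := ne_zero_of_inv_eq_sum_inv hq fun j => (bot_le.trans_lt (hsq j)).ne'
  rw [jointWeight, ← ENNReal.prod_rpow_of_nonneg ENNReal.toReal_nonneg]
  refine Finset.prod_congr rfl fun j _ => ?_
  rw [dualWeight_rpow_sub (hs j) (hsq j), ← ENNReal.rpow_mul,
    toReal_div_mul_toReal_inv hq₀ (le_of_inv_eq_sum_inv hq j)]

theorem pos_of_ofReal_eq {w : ℝ → ℝ} {W : ℝ → ℝ≥0∞} (hW : IsRegularWeight W) {x : ℝ}
    (hx : ENNReal.ofReal (w x) = W x) : 0 < w x :=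
  ENNReal.ofReal_pos.1 (hx ▸ pos_iff_ne_zero.2 (hW.ne_zero x))

theorem ofReal_productWeight_ae_eq (hW : ∀ j, IsRegularWeight (W j))
    (hwW : ∀ j, (fun x => ENNReal.ofReal (w j x)) =ᵐ[volume] W j) :
    (fun x => ENNReal.ofReal (productWeight q q₀ w x)) =ᵐ[volume] jointWeight q q₀ W := by
  filter_upwards [ae_all_iff.2 hwW] with x hx
  have hpos (j : Fin n) : 0 < w j x := pos_of_ofReal_eq (hW j) (hx j)
  rw [productWeight, jointWeight,
    ENNReal.ofReal_prod_of_nonneg fun j _ => Real.rpow_nonneg (hpos j).le _]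
  exact Finset.prod_congr rfl fun j _ => by rw [← ENNReal.ofReal_rpow_of_pos (hpos j), hx j]

theorem ofReal_rpow_ae_eq_dualWeight {s : ℝ≥0} {q : ℝ≥0∞} {w : ℝ → ℝ} {W : ℝ → ℝ≥0∞}
    (hW : IsRegularWeight W) (hwW : (fun x => ENNReal.ofReal (w x)) =ᵐ[volume] W) :
    (fun x => ENNReal.ofReal (w x ^ (-((s : ℝ≥0∞) / (q - (s : ℝ≥0∞))).toReal))) =ᵐ[volume]
      dualWeight s q W := by
  filter_upwards [hwW] with x hx
  rw [← ENNReal.ofReal_rpow_of_pos (pos_of_ofReal_eq hW hx), hx, dualWeight]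

theorem vectorWeightConst_eq_iSup_characteristicOn (hW : ∀ j, IsRegularWeight (W j))
    (hwW : ∀ j, (fun x => ENNReal.ofReal (w j x)) =ᵐ[volume] W j) :
    vectorWeightConst s q q₀ w = ⨆ (a : ℝ) (b : ℝ) (_ : a < b),
      characteristicOn (q₀⁻¹).toReal (fun j => 1 / (s j : ℝ) - ((q j)⁻¹).toReal)
        (jointWeight q q₀ W) (fun j => dualWeight (s j) (q j) (W j)) a b := by
  refine iSup_congr fun a => iSup_congr fun b => iSup_congr fun _ => ?_
  rw [characteristicOn, laverage_congr (ae_restrict_of_ae (ofReal_productWeight_ae_eq hW hwW))]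
  congr 1
  refine Finset.prod_congr rfl fun j _ => ?_
  rw [laverage_congr (ae_restrict_of_ae (ofReal_rpow_ae_eq_dualWeight (hW j) (hwW j)))]

theorem isVectorWeightClass_iff_exists_characteristicOn_le (hW : ∀ j, IsRegularWeight (W j))
    (hwW : ∀ j, (fun x => ENNReal.ofReal (w j x)) =ᵐ[volume] W j) :
    IsVectorWeightClass s q q₀ w ↔ ∃ K : ℝ≥0, ∀ a b, a < b →
      characteristicOn (q₀⁻¹).toReal (fun j => 1 / (s j : ℝ) - ((q j)⁻¹).toReal)
        (jointWeight q q₀ W) (fun j => dualWeight (s j) (q j) (W j)) a b ≤ K := by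
  rw [IsVectorWeightClass, vectorWeightConst_eq_iSup_characteristicOn hW hwW]
  refine ⟨fun h => ?_, fun ⟨K, hK⟩ => ?_⟩
  · obtain ⟨K, hK, -⟩ := ENNReal.lt_iff_exists_coe.1 h
    exact ⟨K, fun a b hab => hK ▸ le_iSup₂_of_le a b (le_iSup_of_le hab le_rfl)⟩
  · exact (iSup₂_le fun a b => iSup_le fun hab => hK a b hab).trans_lt ENNReal.coe_lt_top

theorem eLpNorm_multiMaximal_eq (hq₀ : q₀ ≠ 0) (hW : ∀ j, IsRegularWeight (W j))
    (hwW : ∀ j, (fun x => ENNReal.ofReal (w j x)) =ᵐ[volume] W j) (f : Fin n → ℝ → ℂ) :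
    eLpNorm (multiMaximal s f) q₀ (weightMeasure (productWeight q q₀ w)) =
      eLpNorm (fun x => multilinearMaximal (fun j => 1 / (s j : ℝ))
        (fun j y => ‖f j y‖ₑ ^ (s j : ℝ)) x * jointWeight q q₀ W x ^ (q₀⁻¹).toReal) q₀ volume := by
  rw [weightMeasure, withDensity_congr_ae (ofReal_productWeight_ae_eq hW hwW),
    (isRegularWeight_jointWeight hW q q₀).eLpNorm_withDensity _ hq₀]
  rfl

theorem multiMaximal_congr_ae {f g : Fin n → ℝ → ℂ} (hfg : ∀ j, f j =ᵐ[volume] g j) :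
    multiMaximal s f = multiMaximal s g := by
  ext x
  refine iSup_congr fun a => iSup_congr fun b => iSup_congr fun _ =>
    Finset.prod_congr rfl fun j _ => congrArg (· ^ _) (laverage_congr (ae_restrict_of_ae ?_))
  filter_upwards [hfg j] with y hy using by rw [hy]

theorem isVectorWeightClass_of_eLpNorm_multiMaximal_le (hs : ∀ j, 0 < s j)
    (hsq : ∀ j, (s j : ℝ≥0∞) < q j) (hq : q₀⁻¹ = ∑ j, (q j)⁻¹) (hW : ∀ j, IsRegularWeight (W j))
    (hwW : ∀ j, (fun x => ENNReal.ofReal (w j x)) =ᵐ[volume] W j) {C : ℝ≥0}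
    (hC : ∀ f : Fin n → ℝ → ℂ, (∀ j, AEStronglyMeasurable (f j) volume) →
      eLpNorm (multiMaximal s f) q₀ (weightMeasure (productWeight q q₀ w)) ≤
        (C : ℝ≥0∞) * ∏ j, eLpNorm (f j) (q j) (weightMeasure (w j))) :
    IsVectorWeightClass s q q₀ w := by
  have hq_ne (j : Fin n) : q j ≠ 0 := (bot_le.trans_lt (hsq j)).ne'
  refine (isVectorWeightClass_iff_exists_characteristicOn_le hW hwW).2 ⟨C, fun a b hab => ?_⟩
  refine characteristicOn_le_of_eLpNorm_multilinearMaximal_le hq hq_ne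
    (fun j => toReal_inv_lt_one_div (hs j) (hsq j)) (isRegularWeight_jointWeight hW q q₀)
    (fun j => (hW j).dualWeight (s j) (q j)) (fun g hg hg_top => ?_) hab
  choose f hf hfg using fun j =>
    exists_measurable_enorm_rpow_eq (NNReal.coe_pos.2 (hs j)) (hg j) (hg_top j)
  have h := hC f fun j => (hf j).aestronglyMeasurable
  rw [eLpNorm_multiMaximal_eq (ne_zero_of_inv_eq_sum_inv hq hq_ne) hW hwW] at h
  simpa only [eLpNorm_weightMeasure_eq (hs _) (hsq _) (hW _) (hwW _), hfg] using h

theorem exists_eLpNorm_multiMaximal_le (hs : ∀ j, 0 < s j)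
    (hsq : ∀ j, (s j : ℝ≥0∞) < q j) (hq : q₀⁻¹ = ∑ j, (q j)⁻¹) (hW : ∀ j, IsRegularWeight (W j))
    (hwW : ∀ j, (fun x => ENNReal.ofReal (w j x)) =ᵐ[volume] W j)
    (hclass : IsVectorWeightClass s q q₀ w) :
    ∃ C : ℝ≥0, ∀ f : Fin n → ℝ → ℂ, (∀ j, AEStronglyMeasurable (f j) volume) →
      eLpNorm (multiMaximal s f) q₀ (weightMeasure (productWeight q q₀ w)) ≤
        (C : ℝ≥0∞) * ∏ j, eLpNorm (f j) (q j) (weightMeasure (w j)) := by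
  have hq_ne (j : Fin n) : q j ≠ 0 := (bot_le.trans_lt (hsq j)).ne'
  obtain ⟨K, hK⟩ := (isVectorWeightClass_iff_exists_characteristicOn_le hW hwW).1 hclass
  obtain ⟨C, hC⟩ := exists_eLpNorm_multilinearMaximal_le hq hq_ne
    (fun j => toReal_inv_lt_one_div (hs j) (hsq j)) (isRegularWeight_jointWeight hW q q₀)
    (fun j => (hW j).dualWeight (s j) (q j)) (jointWeight_rpow hs hsq hq W) ENNReal.coe_ne_top hK
  refine ⟨C, fun f hf => ?_⟩
  have hmk (j : Fin n) : eLpNorm (f j) (q j) (weightMeasure (w j)) =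
      eLpNorm ((hf j).mk (f j)) (q j) (weightMeasure (w j)) :=
    eLpNorm_congr_ae ((withDensity_absolutelyContinuous _ _).ae_eq (hf j).ae_eq_mk)
  rw [multiMaximal_congr_ae fun j => (hf j).ae_eq_mk,
    eLpNorm_multiMaximal_eq (ne_zero_of_inv_eq_sum_inv hq hq_ne) hW hwW]
  simp only [hmk, eLpNorm_weightMeasure_eq (hs _) (hsq _) (hW _) (hwW _)]
  exact hC _ fun j => (hf j).stronglyMeasurable_mk.measurable.enorm.pow_const _

end VectorWeight

theorem mainTheorem12_general {n : ℕ} (s : Fin n → ℝ≥0) (q : Fin n → ℝ≥0∞) (q₀ : ℝ≥0∞)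
    (hs : ∀ j, 0 < s j) (hsq : ∀ j, (s j : ℝ≥0∞) < q j) (hq : q₀⁻¹ = ∑ j, (q j)⁻¹)
    (w : Fin n → ℝ → ℝ) (hw : ∀ j, AEMeasurable (w j) volume)
    (hw_pos : ∀ j, ∀ᵐ x ∂(volume : Measure ℝ), 0 < w j x) :
    (∃ C : ℝ≥0, ∀ f : Fin n → ℝ → ℂ, (∀ j, AEStronglyMeasurable (f j) volume) →
      eLpNorm (multiMaximal s f) q₀ (weightMeasure (productWeight q q₀ w)) ≤
        (C : ℝ≥0∞) * ∏ j, eLpNorm (f j) (q j) (weightMeasure (w j))) ↔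
    IsVectorWeightClass s q q₀ w := by
  choose W hW hwW using fun j => exists_isRegularWeight_ae_eq (hw j) (hw_pos j)
  exact ⟨fun ⟨_, hC⟩ => isVectorWeightClass_of_eLpNorm_multiMaximal_le hs hsq hq hW hwW hC,
    exists_eLpNorm_multiMaximal_le hs hsq hq hW hwW⟩

theorem mainTheorem12 {n : ℕ} (s : Fin n → ℝ≥0) (q : Fin n → ℝ≥0∞) (q₀ : ℝ≥0∞)
    (hs : ∀ j, 1 ≤ s j) (hsq : ∀ j, (s j : ℝ≥0∞) < q j)
    (hq : q₀⁻¹ = ∑ j, (q j)⁻¹)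
    (w : Fin n → ℝ → ℝ) (hw : ∀ j, IsWeight (w j))
    (hw_one : ∀ j, q j = ∞ → ∀ x, w j x = 1) :
    (∃ C : ℝ≥0, ∀ f : Fin n → ℝ → ℂ, (∀ j, AEStronglyMeasurable (f j) volume) →
      eLpNorm (multiMaximal s f) q₀ (weightMeasure (productWeight q q₀ w)) ≤
        (C : ℝ≥0∞) * ∏ j, eLpNorm (f j) (q j) (weightMeasure (w j))) ↔
    IsVectorWeightClass s q q₀ w := by
  exact mainTheorem12_general s q q₀ (fun j => zero_lt_one.trans_le (hs j)) hsq hq w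
    (fun j => (hw j).1.aestronglyMeasurable.aemeasurable) fun j => (hw j).2
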